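/- Let $\nu$ be a probability law on $\mathbb Z_{\ge0}$ with mean $1$ and finite variance $\Sigma^2$, $\nu\ne\delta_1$, and let $\mu$ be a probability law on $\mathbb Z_{\ge 0}$ with mean $m$ and finite variance $\sigma^2$. Let $\mathcal T$ be the (unconditioned, almost surely finite) Galton–Watson plane tree with offspring distribution $\nu$. Given a finite rooted plane tree $\mathfrak t$ and a labeling $\ell:\mathfrak t\to\mathbb Z_{\ge0}$ of its vertices, let $\ell(x)$ cars arrive at each vertex $x$. The cars park one after the other: each takes the first free vertex on the path from its arrival vertex down to the root, each vertex accommodates at most one car, and a car that finds no free vertex on this path leaves the tree through the root. The flux $\varphi(\mathfrak t,\ell)$ is the number of cars that leave the tree (it does not depend on the order in which the cars park). Conditionally on $\mathcal T$, let $(A_x,L_x)_{x\in\mathcal T}$ be independent with law $\mathrm{Unif}[0,1]\otimes\mu$. For $t\in[0,1]$ put $L^{(t)}(x)=\mathbf 1_{A_x\le t}L_x$ and $\varphi(t)=\varphi(\mathcal T,L^{(t)})$, and let $\varPhi(t)=\mathbb E[\varphi(t)]\in[0,\infty]$. Equivalently, $\varPhi(t)$ is the mean flux in $\mathcal T$ with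 i.i.d. car arrivals of law $\mu_t=(1-t)\delta_0+t\mu$. Let $t_{\max}$ be the smallest positive solution $t$ of $$(1-mt)^2=t\,\Sigma^2(\sigma^2+m^2-m),$$ with $t_{\max}=+\infty$ if there is no such solution. Then, for every $t\in[0,1]$, $$\varPhi(t)=\begin{cases}\dfrac{(1-mt)-\sqrt{(1-mt)^2-\Sigma^2(\sigma^2+m^2-m)\,t}}{\Sigma^2}&\text{if }t\le t_{\max},\\[2mm]+\infty&\text{if }t>t_{\max}.\end{cases}$$ -/

import Mathlib

open MeasureTheory ProbabilityTheory

/-! ### Parking on a finite rooted plane tree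

Vertices of plane trees are words on `ℕ` (Ulam-Harris labels), with the *last* step of the path
from the root written first: the root is `[]`, the `i`-th child of `u` is `i :: u`, and the parent
of `i :: u` is `u`. -/

/-- The spot taken by a car arriving at the given vertex when the spots in `occ` are occupied: the
first free vertex on the path from the arrival vertex down to the root, or `none` if there is no
free vertex on this path (the car then exits the tree through the root). -/
def parkingSpot (occ : Finset (List ℕ)) : List ℕ → Option (List ℕ)
  | [] => if [] ∈ occ then none else some []
  | i :: u => if i :: u ∈ occ then parkingSpot occ u else some (i :: u)

/-- One car arrives at `x`. The state records the set of occupied spots and the number of cars that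
have left the tree through the root so far. -/
def parkCar (s : Finset (List ℕ) × ℕ) (x : List ℕ) : Finset (List ℕ) × ℕ :=
  match parkingSpot s.1 x with
  | none => (s.1, s.2 + 1)
  | some v => (insert v s.1, s.2)

/-- Occupying one more spot `v` changes the spot found by a car only if that spot was `v`; in that
case the car goes on from `v`. -/
theorem parkingSpot_insert (occ : Finset (List ℕ)) (x v : List ℕ) :
    parkingSpot (insert v occ) x =
      if parkingSpot occ x = some v then parkingSpot (insert v occ) v
      else parkingSpot occ x := by
  induction x with
  | nil =>
    by_cases h : ([] : List ℕ) ∈ occ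
    · simp [parkingSpot, h]
    · by_cases hv : v = []
      · subst hv; simp [parkingSpot, h]
      · simp [parkingSpot, h, Ne.symm hv]
  | cons i u ih =>
    by_cases h : i :: u ∈ occ
    · simp only [parkingSpot, Finset.mem_insert, h, or_true, if_true]
      exact ih
    · by_cases hv : v = i :: u
      · subst hv; simp [parkingSpot, h]
      · simp [parkingSpot, h, Ne.symm hv]

/-- The Abelian property: exchanging two consecutive cars changes neither the set of occupied
spots nor the number of cars that leave the tree. -/
instance parkCar_rightCommutative : RightCommutative parkCar where
  right_comm := by
    rintro ⟨occ, n⟩ x y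
    rcases hx : parkingSpot occ x with _ | v <;> rcases hy : parkingSpot occ y with _ | w
    · simp [parkCar, hx, hy]
    · simp [parkCar, hx, hy, parkingSpot_insert occ x w]
    · simp [parkCar, hx, hy, parkingSpot_insert occ y v]
    · by_cases hvw : v = w
      · subst hvw
        simp [parkCar, hx, hy, parkingSpot_insert occ y v, parkingSpot_insert occ x v]
      · simp [parkCar, hx, hy, parkingSpot_insert occ y v, parkingSpot_insert occ x w, hvw,
          Ne.symm hvw, Finset.insert_comm v w]

/-- The flux `φ(τ, ℓ)` of the finite tree `τ` with `ℓ x` cars arriving at each vertex `x` of `τ`: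
the cars park one after the other, starting from the empty tree, and the flux is the number of cars
that leave the tree through the root. -/
def flux (τ : Finset (List ℕ)) (ℓ : List ℕ → ℕ) : ℕ :=
  ((∑ x ∈ τ, Multiset.replicate (ℓ x) x).foldl parkCar (∅, 0)).2

/-! ### Galton-Watson trees -/

/-- `InTree k u`: the word `u` is a vertex of the plane tree in which every vertex `v` has `k v`
children `0 :: v, …, (k v - 1) :: v`. -/
def InTree (k : List ℕ → ℕ) : List ℕ → Prop
  | [] => True
  | i :: u => i < k u ∧ InTree k u

/-- The plane tree with offspring numbers `k`, as its set of vertices. If the `k u` are i.i.d. with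
law `ν`, this is the Galton-Watson tree with offspring distribution `ν`. -/
def planeTree (k : List ℕ → ℕ) : Set (List ℕ) := {u | InTree k u}

open Classical in
/-- The flux at the root of the tree with offspring numbers `k` and car arrivals `ℓ`. The value at
infinite trees is immaterial: a critical Galton-Watson tree is almost surely finite. -/
noncomputable def treeFlux (k ℓ : List ℕ → ℕ) : ℕ :=
  if h : (planeTree k).Finite then flux h.toFinset ℓ else 0

/-- The mean flux at the root of a Galton-Watson tree with offspring distribution `ν` and i.i.d.
car arrivals with law `ρ`; a value in `[0, ∞]`. -/
noncomputable def meanFlux (ν ρ : Measure ℕ) [IsProbabilityMeasure ν] [IsProbabilityMeasure ρ] :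
    ENNReal :=
  ∫⁻ ω : List ℕ → ℕ × ℕ, (treeFlux (fun u => (ω u).1) (fun u => (ω u).2) : ENNReal)
    ∂(Measure.infinitePi fun _ : List ℕ => ν.prod ρ)

/-- The thinned law `μ_t = (1 - t) δ₀ + t μ`, for `t ∈ [0, 1]`. -/
noncomputable def thinned (μ : Measure ℕ) (t : Set.Icc (0 : ℝ) 1) : Measure ℕ :=
  ENNReal.ofReal (1 - (t : ℝ)) • Measure.dirac 0 + ENNReal.ofReal (t : ℝ) • μ

instance thinned_isProbabilityMeasure (μ : Measure ℕ) [IsProbabilityMeasure μ]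
    (t : Set.Icc (0 : ℝ) 1) : IsProbabilityMeasure (thinned μ t) where
  measure_univ := by
    have h0 : (0 : ℝ) ≤ t := t.2.1
    have h1 : (0 : ℝ) ≤ 1 - t := sub_nonneg.2 t.2.2
    simp [thinned, ← ENNReal.ofReal_add h1 h0]

/-- The thinned labels `L^{(t)}(x) = 1_{A_x ≤ t} L_x`, for arrival times `A_x` and arrival
numbers `L_x`. -/
noncomputable def arrivedBy (t : ℝ) (A : List ℕ → ℝ) (L : List ℕ → ℕ) (x : List ℕ) : ℕ :=
  if A x ≤ t then L x else 0

/-- The mean of a law on `ℕ`. -/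
noncomputable def natMean (μ : Measure ℕ) : ℝ := ∫ n : ℕ, (n : ℝ) ∂μ

/-- The variance of a law on `ℕ`. -/
noncomputable def natVar (μ : Measure ℕ) : ℝ := variance (fun n : ℕ => (n : ℝ)) μ

/-- The smallest positive solution of `(1 - m t)² = t Σ² (σ² + m² - m)`, and `⊤` if there is none
(`S2` stands for `Σ²` and `s2` for `σ²`). The infimum is a minimum whenever there is a solution: the
equation is polynomial and `0` is not a root. -/
noncomputable def tMax (m s2 S2 : ℝ) : EReal :=
  sInf ((fun t : ℝ => (t : EReal)) ''
    {t : ℝ | 0 < t ∧ (1 - m * t) ^ 2 = t * S2 * (s2 + m ^ 2 - m)})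

/-! ### The recursive structure of parking -/

/-! Cutting the tree at the root shows that the flux `X` satisfies `X = (L + X₁ + ⋯ + X_K - 1)⁺`,
with independent copies `Xᵢ` of `X` above the `K` children; on the probabilistic side this is
`lintegral_branching`. For generating functions at `1 - u` it becomes `ParkingEquation`. Only the
means of the unknown variables have to be finite to expand this equation to second order at `u = 0`:
the terms `E[geomSum u X]` of the two sides cancel, because `ν` has mean `1`, while the laws `ν` and
`ρ` are expanded using their second moments (`ParkingEquation.exists_remainder`).

Write `a = E[L]`, `c = E[K(K-1)]/2`, `d = E[L(L-1)]/2` and `Q(x) = c x² + a x + d`. If the flux has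
finite mean `h`, the first order gives `a ≤ 1` and the second gives `h = Q(h)` (`meanFlux_fixed`).
Conversely, let `X_n` be the flux when cars arrive below height `n` only. As `X_n ≤ X_{n+1}`, the
same expansion yields `E[X_{n+1}] ≤ Q(E[X_n])`. Since `Q` is nondecreasing on `[0, ∞)`, every
nonnegative fixed point of `Q` bounds all these means, hence the mean flux (`meanFlux_le`). So the
mean flux is the smallest nonnegative fixed point of `Q` if there is one, and infinite otherwise.

For the thinned law, `Q` has coefficients `Σ²/2`, `mt` and `t(σ² + m² - m)/2`. Up to `t_max` its
discriminant is nonnegative and `mt ≤ 1`, so the smaller root is the answer. Beyond `t_max`, either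
`mt > 1` or the discriminant is negative, and both exclude a finite mean. -/

theorem parkingSpot_eq_none {occ : Finset (List ℕ)} {x : List ℕ} (h : parkingSpot occ x = none) :
    ∀ u, u <:+ x → u ∈ occ := by
  induction x with
  | nil =>
    intro u hu
    rw [List.suffix_nil] at hu
    subst hu
    by_contra h0
    simp [parkingSpot, h0] at h
  | cons i x ih =>
    intro u hu
    by_cases h0 : i :: x ∈ occ
    · simp only [parkingSpot, h0, if_true] at h
      rcases List.suffix_cons_iff.1 hu with rfl | hu
      · exact h0
      · exact ih h u hu
    · simp [parkingSpot, h0] at h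

/-- The last clause says that every free spot on the path of the car lies between `v` and the root:
the spots passed before `v` are all occupied. -/
theorem parkingSpot_eq_some {occ : Finset (List ℕ)} {x v : List ℕ}
    (h : parkingSpot occ x = some v) :
    v ∉ occ ∧ v <:+ x ∧ ∀ u, u <:+ x → u ∈ occ ∨ u <:+ v := by
  induction x with
  | nil =>
    by_cases h0 : ([] : List ℕ) ∈ occ
    · simp [parkingSpot, h0] at h
    · simp only [parkingSpot, h0, if_false, Option.some.injEq] at h
      subst h
      exact ⟨h0, List.suffix_refl _, fun u hu => Or.inr hu⟩
  | cons i x ih =>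
    by_cases h0 : i :: x ∈ occ
    · simp only [parkingSpot, h0, if_true] at h
      obtain ⟨h1, h2, h3⟩ := ih h
      refine ⟨h1, h2.trans (List.suffix_cons i x), fun u hu => ?_⟩
      rcases List.suffix_cons_iff.1 hu with rfl | hu
      · exact Or.inl h0
      · exact h3 u hu
    · simp only [parkingSpot, h0, if_false, Option.some.injEq] at h
      subst h
      exact ⟨h0, List.suffix_refl _, fun u hu => Or.inr hu⟩

/-- The number of words of `M` in the subtree above `u`. -/
def countAbove (u : List ℕ) (M : Multiset (List ℕ)) : ℕ := M.countP (u <:+ ·)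

theorem countAbove_cons (u x : List ℕ) (M : Multiset (List ℕ)) :
    countAbove u (x ::ₘ M) = countAbove u M + if u <:+ x then 1 else 0 :=
  Multiset.countP_cons _ _ _

/-- A word above `u` is `u` itself or passes through exactly one child of `u`; the hypothesis keeps
these children below `k`. -/
theorem countAbove_eq_sum {u : List ℕ} {k : ℕ} {M : Multiset (List ℕ)}
    (h : ∀ x ∈ M, ∀ i, i :: u <:+ x → i < k) :
    countAbove u M = M.count u + ∑ i ∈ Finset.range k, countAbove (i :: u) M := by
  induction M using Multiset.induction with
  | empty => simp [countAbove]
  | cons x M ih =>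
    have ih := ih fun y hy => h y (Multiset.mem_cons_of_mem hy)
    have hx := h x (Multiset.mem_cons_self x M)
    simp only [countAbove_cons, Multiset.count_cons, Finset.sum_add_distrib, ih]
    suffices (if u <:+ x then 1 else 0) = (if u = x then 1 else 0) +
      ∑ i ∈ Finset.range k, if i :: u <:+ x then 1 else 0 by omega
    by_cases hu : u <:+ x
    · obtain ⟨w, rfl⟩ := hu
      rcases List.eq_nil_or_concat w with rfl | ⟨w, j, rfl⟩
      · have : ∀ i : ℕ, ¬ (i :: u <:+ [] ++ u) := fun i hi => by
          have := hi.length_le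
          simp at this
        simp_all
      · have hj : ∀ i : ℕ, i :: u <:+ w ++ [j] ++ u ↔ i = j := by
          intro i
          constructor
          · rintro ⟨w', hw⟩
            have h1 : (w' ++ [i]) ++ u = (w ++ [j]) ++ u := by simpa using hw
            have h2 := List.append_cancel_right h1
            exact (List.append_inj' h2 rfl).2 |> List.singleton_inj.1
          · rintro rfl
            exact ⟨w, by simp⟩
        have hne : u ≠ w ++ [j] ++ u := fun hh => by
          have := congrArg List.length hh
          simp only [List.length_append, List.length_singleton] at this
          omega
        have hjk : j < k := hx j (by rw [List.concat_eq_append]; exact (hj j).2 rfl)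
        rw [List.concat_eq_append, if_pos ⟨w ++ [j], rfl⟩, if_neg hne]
        simp only [hj, Finset.sum_ite_eq', Finset.mem_range, hjk, if_true, zero_add]
    · have h1 : u ≠ x := fun hh => hu (hh ▸ List.suffix_refl u)
      have h2 : ∀ i : ℕ, ¬ (i :: u <:+ x) := fun i hi => hu ((List.suffix_cons i u).trans hi)
      simp [hu, h1, h2]

/-- Conservation of cars: in the subtree above any vertex, no more spots are occupied than cars
have arrived, with equality if the vertex is free. -/
theorem foldl_parkCar_balance (M : Multiset (List ℕ)) :
    let s := M.foldl parkCar (∅, 0)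
    M.card = s.1.card + s.2 ∧ (∀ u, countAbove u s.1.val ≤ countAbove u M) ∧
      ∀ u ∉ s.1, countAbove u M = countAbove u s.1.val := by
  induction M using Multiset.induction with
  | empty => simp [countAbove]
  | cons x M ih =>
    have hfold : (x ::ₘ M).foldl parkCar (∅, 0) = parkCar (M.foldl parkCar (∅, 0)) x := by
      rw [← Multiset.singleton_add, add_comm, Multiset.foldl_add]
      rfl
    rw [hfold]
    set s := M.foldl parkCar (∅, 0)
    obtain ⟨h1, h2, h3⟩ := ih
    dsimp only
    simp only [countAbove_cons]
    rcases hx : parkingSpot s.1 x with _ | v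
    · have hs := parkingSpot_eq_none hx
      simp only [parkCar, hx, Multiset.card_cons]
      refine ⟨by omega, fun u => (h2 u).trans (Nat.le_add_right _ _), fun u hu => ?_⟩
      rw [if_neg fun h => hu (hs u h), h3 u hu, add_zero]
    · obtain ⟨hv, hvx, hs⟩ := parkingSpot_eq_some hx
      simp only [parkCar, hx, Multiset.card_cons, Finset.card_insert_of_notMem hv,
        Finset.insert_val_of_notMem hv, countAbove_cons]
      refine ⟨by omega, fun u => ?_, fun u hu => ?_⟩
      · refine add_le_add (h2 u) ?_
        by_cases hu : u <:+ v
        · simp [hu, hu.trans hvx]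
        · simp [hu]
      · rw [Finset.mem_insert, not_or] at hu
        rw [h3 u hu.2]
        congr 1
        refine if_congr ⟨fun h => (hs u h).resolve_left hu.2, fun h => h.trans hvx⟩ rfl rfl

/-- The number of cars of `M` that leave the subtree above `u`. -/
def outflow (M : Multiset (List ℕ)) (u : List ℕ) : ℕ :=
  countAbove u M - countAbove u (M.foldl parkCar (∅, 0)).1.val

theorem outflow_nil (M : Multiset (List ℕ)) : outflow M [] = (M.foldl parkCar (∅, 0)).2 := by
  have h := (foldl_parkCar_balance M).1
  have hcard : ∀ M : Multiset (List ℕ), countAbove [] M = M.card := fun M =>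
    Multiset.countP_eq_card.2 fun x _ => List.nil_suffix
  rw [outflow, hcard, hcard, h, Finset.card_def]
  omega

/-- Both counts in `outflow` split over `u` and its children, so the only loss at `u` is the spot
`u`. If that spot stays free, the balance forces no arrival at `u` and no outflow from the children,
and the truncated subtraction gives `0 - 1 = 0`. -/
theorem outflow_eq {M : Multiset (List ℕ)} {u : List ℕ} {k : ℕ}
    (h : ∀ x ∈ M, ∀ i, i :: u <:+ x → i < k) :
    outflow M u = (M.count u + ∑ i ∈ Finset.range k, outflow M (i :: u)) - 1 := by
  obtain ⟨-, h2, h3⟩ := foldl_parkCar_balance M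
  unfold outflow
  set s := M.foldl parkCar (∅, 0)
  -- An occupied spot above `i :: u` requires a car that arrived above `i :: u`, so occupied spots
  -- inherit the bound on children.
  have hs : ∀ x ∈ s.1.val, ∀ i, i :: u <:+ x → i < k := by
    intro x hx i hi
    have h4 : 0 < countAbove (i :: u) M :=
      lt_of_lt_of_le (Multiset.countP_pos.2 ⟨x, hx, hi⟩) (h2 _)
    obtain ⟨y, hy, hiy⟩ := Multiset.countP_pos.1 h4
    exact h y hy i hiy
  have hM := countAbove_eq_sum h
  have hO := countAbove_eq_sum hs
  have hsum : ∑ i ∈ Finset.range k, (countAbove (i :: u) M - countAbove (i :: u) s.1.val) +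
      ∑ i ∈ Finset.range k, countAbove (i :: u) s.1.val
      = ∑ i ∈ Finset.range k, countAbove (i :: u) M := by
    rw [← Finset.sum_add_distrib]
    exact Finset.sum_congr rfl fun i _ => Nat.sub_add_cancel (h2 _)
  have h2u := h2 u
  have hc := Multiset.nodup_iff_count_le_one.1 s.1.nodup u
  by_cases hu : u ∈ s.1
  · have : Multiset.count u s.1.val = 1 := Multiset.count_eq_one_of_mem s.1.nodup hu
    omega
  · have h4 : Multiset.count u s.1.val = 0 := Multiset.count_eq_zero_of_notMem hu
    have := h3 u hu
    omega

/-! ### Marked trees as functions on words -/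

/-- The marked tree above the child `i` of the root. -/
def subtree {E : Type*} (i : ℕ) (ω : List ℕ → E) : List ℕ → E := fun v => ω (v ++ [i])

/-- The flux at the root when cars arrive at the vertices of height less than `n` only. -/
def levelFlux : ℕ → (List ℕ → ℕ × ℕ) → ℕ
  | 0, _ => 0
  | n + 1, ω => ((ω []).2 + ∑ i ∈ Finset.range (ω []).1, levelFlux n (subtree i ω)) - 1

/-- The tree has no vertex of height `n`. -/
def HeightLT : ℕ → (List ℕ → ℕ × ℕ) → Prop
  | 0, _ => False
  | n + 1, ω => ∀ i < (ω []).1, HeightLT n (subtree i ω)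

theorem levelFlux_le_succ (n : ℕ) (ω : List ℕ → ℕ × ℕ) :
    levelFlux n ω ≤ levelFlux (n + 1) ω := by
  induction n generalizing ω with
  | zero => exact Nat.zero_le _
  | succ n ih =>
    rw [levelFlux, levelFlux]
    exact Nat.sub_le_sub_right
      (Nat.add_le_add_left (Finset.sum_le_sum fun i _ => ih (subtree i ω)) _) _

theorem HeightLT.succ {n : ℕ} {ω : List ℕ → ℕ × ℕ} (h : HeightLT n ω) : HeightLT (n + 1) ω := by
  induction n generalizing ω with
  | zero => exact h.elim
  | succ n ih => exact fun i hi => ih (h i hi)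

theorem HeightLT.mono {n n' : ℕ} {ω : List ℕ → ℕ × ℕ} (h : HeightLT n ω) (hn : n ≤ n') :
    HeightLT n' ω := by
  induction hn with
  | refl => exact h
  | step _ ih => exact ih.succ

theorem inTree_append {k : List ℕ → ℕ} {v u : List ℕ} :
    InTree k (v ++ u) ↔ InTree (fun w => k (w ++ u)) v ∧ InTree k u := by
  induction v with
  | nil => simp [InTree]
  | cons i v ih => simp [InTree, ih, and_assoc]

theorem HeightLT.finite {n : ℕ} {ω : List ℕ → ℕ × ℕ} (h : HeightLT n ω) :
    (planeTree fun u => (ω u).1).Finite := by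
  induction n generalizing ω with
  | zero => exact h.elim
  | succ n ih =>
    have hfin : ({[]} ∪ ⋃ i ∈ Finset.range (ω []).1,
        (· ++ [i]) '' planeTree fun u => (subtree i ω u).1).Finite := by
      refine (Set.finite_singleton _).union (Set.Finite.biUnion (Finset.finite_toSet _) ?_)
      exact fun i hi => (ih (h i (Finset.mem_range.1 hi))).image _
    refine hfin.subset fun u hu => ?_
    rcases List.eq_nil_or_concat u with rfl | ⟨v, i, rfl⟩
    · exact Or.inl rfl
    · rw [List.concat_eq_append] at hu ⊢
      obtain ⟨h1, h2⟩ := inTree_append.1 hu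
      refine Or.inr (Set.mem_biUnion (x := i) ?_ ⟨v, h1, rfl⟩)
      simpa [InTree] using h2

/-- Both quantities obey the same recursion over children. The vertex `u` is arbitrary so that the
induction can move up the tree while `M` stays fixed. -/
theorem HeightLT.outflow_eq_levelFlux {ω : List ℕ → ℕ × ℕ} {M : Multiset (List ℕ)}
    (hM : ∀ x ∈ M, InTree (fun u => (ω u).1) x)
    (hc : ∀ u, InTree (fun u => (ω u).1) u → M.count u = (ω u).2) {n : ℕ} {u : List ℕ}
    (hu : InTree (fun u => (ω u).1) u) (h : HeightLT n fun v => ω (v ++ u)) :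
    outflow M u = levelFlux n fun v => ω (v ++ u) := by
  induction n generalizing u with
  | zero => exact h.elim
  | succ n ih =>
    have hsub : ∀ i, subtree i (fun v => ω (v ++ u)) = fun v => ω (v ++ i :: u) := by
      intro i
      ext v : 1
      simp [subtree]
    rw [outflow_eq (k := (ω u).1), hc u hu, levelFlux]
    · simp only [hsub, List.nil_append]
      congr 2
      refine Finset.sum_congr rfl fun i hi => ih ⟨Finset.mem_range.1 hi, hu⟩ ?_
      rw [← hsub]
      exact h i (Finset.mem_range.1 hi)
    · rintro x hx i ⟨w, rfl⟩
      exact (inTree_append.1 (hM _ hx)).2.1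

/-- This replaces the flux, defined by parking on a finite tree, by `levelFlux`, which is recursive,
measurable and defined on infinite trees too. -/
theorem HeightLT.treeFlux_eq {n : ℕ} {ω : List ℕ → ℕ × ℕ} (h : HeightLT n ω) :
    treeFlux (fun u => (ω u).1) (fun u => (ω u).2) = levelFlux n ω := by
  have hf := h.finite
  rw [treeFlux, dif_pos hf, flux, ← outflow_nil]
  have h' : HeightLT n fun v => ω (v ++ []) := by simpa using h
  have hmem : ∀ u, u ∈ hf.toFinset ↔ InTree (fun u => (ω u).1) u := fun u => hf.mem_toFinset
  have hnil : InTree (fun u => (ω u).1) [] := trivial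
  refine (h'.outflow_eq_levelFlux ?_ ?_ hnil).trans (by simp)
  · intro x hx
    obtain ⟨y, hy, hxy⟩ := Multiset.mem_sum.1 hx
    rw [Multiset.eq_of_mem_replicate hxy]
    exact (hmem y).1 hy
  · intro u hu
    rw [Multiset.count_sum']
    simp [Multiset.count_replicate, (hmem u).2 hu]

/-- The flux at the root is determined by the car arrivals at the root and by the fluxes at its
children. -/
theorem treeFlux_eq_of_heightLT {n : ℕ} {ω : List ℕ → ℕ × ℕ} (h : HeightLT n ω) :
    treeFlux (fun u => (ω u).1) (fun u => (ω u).2) =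
      ((ω []).2 + ∑ i ∈ Finset.range (ω []).1,
        treeFlux (fun u => (subtree i ω u).1) (fun u => (subtree i ω u).2)) - 1 := by
  -- With the bound raised to `n + 1`, every child subtree satisfies the bound `n`.
  rw [h.succ.treeFlux_eq, levelFlux]
  congr 2
  exact Finset.sum_congr rfl fun i hi =>
    (HeightLT.treeFlux_eq (h.succ i (Finset.mem_range.1 hi))).symm

/-! ### Independence of the subtrees above the root -/

section Branching

variable {E : Type*} [MeasurableSpace E]

/-- The words whose path leaves the root through a given child, or the root itself. -/
abbrev BranchIndex : Option ℕ → Type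
  | none => Unit
  | some _ => List ℕ

/-- The decomposition of a word according to the first step of its path from the root. -/
def branchWord : (Σ i, BranchIndex i) → List ℕ
  | ⟨none, _⟩ => []
  | ⟨some i, v⟩ => v ++ [i]

theorem branchWord_injective : Function.Injective branchWord := by
  rintro ⟨_ | i, v⟩ ⟨_ | j, w⟩ h
  · rfl
  · simp [branchWord] at h
  · simp [branchWord] at h
  · have h' := List.append_inj' (show v ++ [i] = w ++ [j] from h) rfl
    obtain rfl : v = w := h'.1
    obtain rfl : i = j := List.singleton_inj.1 h'.2
    rfl

/-- The restriction of a marked tree to a branch. -/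
def branch (i : Option ℕ) (ω : List ℕ → E) : BranchIndex i → E := fun v => ω (branchWord ⟨i, v⟩)

theorem measurable_branch (i : Option ℕ) : Measurable (branch (E := E) i) :=
  measurable_pi_iff.2 fun _ => measurable_pi_apply _

theorem measurable_subtree (i : ℕ) : Measurable (subtree (E := E) i) :=
  measurable_pi_iff.2 fun _ => measurable_pi_apply _

variable (π : Measure E) [IsProbabilityMeasure π]

/-- Since `branchWord` is injective, the joint law of the branches is the product measure reindexed
by a sigma type, and currying it gives the product of the laws of the branches. -/
theorem iIndepFun_branch :
    iIndepFun (branch (E := E)) (Measure.infinitePi fun _ : List ℕ => π) := by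
  rw [iIndepFun_iff_map_fun_eq_infinitePi_map measurable_branch]
  have h1 : ∀ i, (Measure.infinitePi fun _ : List ℕ => π).map (branch i) =
      Measure.infinitePi fun _ : BranchIndex i => π := fun i =>
    Measure.map_infinitePi_infinitePi_of_inj (P := fun _ : List ℕ => π)
      (f := fun v : BranchIndex i => branchWord ⟨i, v⟩)
      fun v w h => eq_of_heq (Sigma.mk.inj (branchWord_injective h)).2
  have h2 := Measure.map_infinitePi_infinitePi_of_inj (P := fun _ : List ℕ => π)
    branchWord_injective
  have h3 := Measure.infinitePi_map_piCurry (X := fun (i : Option ℕ) (_ : BranchIndex i) => E)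
    (fun _ _ => π)
  simp_rw [h1]
  rw [← h3, ← h2, Measure.map_map (by fun_prop) (by fun_prop)]
  rfl

theorem measurePreserving_subtree (i : ℕ) :
    MeasurePreserving (subtree (E := E) i) (Measure.infinitePi fun _ : List ℕ => π)
      (Measure.infinitePi fun _ : List ℕ => π) :=
  ⟨measurable_subtree i, Measure.map_infinitePi_infinitePi_of_inj (P := fun _ : List ℕ => π)
    (f := fun v : List ℕ => v ++ [i]) fun _ _ h => List.append_cancel_right h⟩

theorem lintegral_root_mul_prod {ψ : E → ENNReal} (hψ : Measurable ψ)
    {φ : (List ℕ → E) → ENNReal} (hφ : Measurable φ) (n : ℕ) :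
    ∫⁻ ω, ψ (ω []) * ∏ i ∈ Finset.range n, φ (subtree i ω) ∂Measure.infinitePi (fun _ => π) =
      (∫⁻ a, ψ a ∂π) * (∫⁻ ω, φ ω ∂Measure.infinitePi fun _ => π) ^ n := by
  let X : Option ℕ → (List ℕ → E) → ENNReal := fun o =>
    match o with
    | none => fun ω => ψ (ω [])
    | some i => fun ω => φ (subtree i ω)
  have hX : ∀ o, Measurable (X o) := by
    rintro (_ | i)
    · exact hψ.comp (measurable_pi_apply _)
    · exact hφ.comp (measurable_subtree i)
  let g : ∀ o, (BranchIndex o → E) → ENNReal := fun o =>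
    match o with
    | none => fun v => ψ (v ())
    | some _ => φ
  have hg : ∀ o, Measurable (g o) := by
    rintro (_ | i)
    · exact hψ.comp (measurable_pi_apply _)
    · exact hφ
  have hind : iIndepFun X (Measure.infinitePi fun _ : List ℕ => π) := by
    convert! (iIndepFun_branch π).comp g hg using 1
    funext o
    cases o <;> rfl
  have h := lintegral_prod_eq_prod_lintegral_of_indepFun
    (Finset.insertNone (Finset.range n)) X hind hX
  simp only [Finset.insertNone] at h
  simp only [OrderEmbedding.coe_ofMapLEIff, Finset.prod_cons, Finset.prod_map,
    Function.Embedding.some_apply, X] at h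
  rw [h]
  congr 1
  · exact (measurePreserving_eval_infinitePi (fun _ : List ℕ => π) []).lintegral_comp hψ
  · rw [Finset.prod_congr rfl fun i _ => (measurePreserving_subtree π i).lintegral_comp hφ]
    simp

/-- The branching property: given the mark of the root, the subtrees above the children of the root
are independent and distributed as the whole tree. -/
theorem lintegral_branching {k : E → ℕ} (hk : Measurable k) {ψ : E → ENNReal} (hψ : Measurable ψ)
    {φ : (List ℕ → E) → ENNReal} (hφ : Measurable φ) :
    ∫⁻ ω, ψ (ω []) * ∏ i ∈ Finset.range (k (ω [])), φ (subtree i ω)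
        ∂Measure.infinitePi (fun _ => π) =
      ∫⁻ a, ψ a * (∫⁻ ω, φ ω ∂Measure.infinitePi fun _ => π) ^ k a ∂π := by
  have hind : ∀ n, Measurable ((k ⁻¹' {n}).indicator ψ) := fun n =>
    hψ.indicator (hk (measurableSet_singleton n))
  -- Splitting according to the value of `k` reduces a random number of subtrees to a fixed one.
  have key : ∀ (a : E) (f : ℕ → ENNReal),
      ψ a * f (k a) = ∑' n, (k ⁻¹' {n}).indicator ψ a * f n := by
    intro a f
    rw [tsum_eq_single (k a)]
    · simp
    · intro n hn
      simp [hn.symm]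
  refine (lintegral_congr fun ω => key (ω []) fun n =>
    ∏ i ∈ Finset.range n, φ (subtree i ω)).trans (Eq.trans ?_ (lintegral_congr fun a => key a
      fun n => (∫⁻ ω, φ ω ∂Measure.infinitePi fun _ => π) ^ n).symm)
  rw [lintegral_tsum, lintegral_tsum]
  · refine tsum_congr fun n => ?_
    rw [lintegral_root_mul_prod π (hind n) hφ, lintegral_mul_const _ (hind n)]
  · exact fun n => ((hind n).mul_const _).aemeasurable
  · refine fun n => Measurable.aemeasurable ?_
    refine ((hind n).comp (measurable_pi_apply _)).mul ?_
    exact Finset.measurable_prod _ fun i _ => hφ.comp (measurable_subtree i)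

end Branching

/-! ### Expansion of generating functions at `1` -/

section Expansion

open Filter Topology

/-- The quotient `(1 - (1 - u) ^ n) / u`. -/
noncomputable def geomSum (u : ℝ) (n : ℕ) : ℝ := ∑ j ∈ Finset.range n, (1 - u) ^ j

/-- The quotient `((1 - u) ^ n - 1 + n u) / u ^ 2`. -/
noncomputable def geomSumSum (u : ℝ) (n : ℕ) : ℝ := ∑ i ∈ Finset.range n, geomSum u i

theorem one_sub_pow_eq (u : ℝ) (n : ℕ) : (1 - u) ^ n = 1 - u * geomSum u n := by
  induction n with
  | zero => simp [geomSum]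
  | succ n ih =>
    rw [geomSum, Finset.sum_range_succ, ← geomSum, pow_succ, mul_add, ih]
    linear_combination (-u) * ih + u * ih

theorem geomSum_eq (u : ℝ) (n : ℕ) : geomSum u n = n - u * geomSumSum u n := by
  induction n with
  | zero => simp [geomSum, geomSumSum]
  | succ n ih =>
    rw [geomSumSum, Finset.sum_range_succ, ← geomSumSum, geomSum, Finset.sum_range_succ,
      ← geomSum, one_sub_pow_eq]
    push_cast
    linear_combination ih

theorem geomSum_zero (n : ℕ) : geomSum 0 n = n := by simp [geomSum]

theorem geomSumSum_zero (n : ℕ) : geomSumSum 0 n = (n : ℝ) * (n - 1) / 2 := by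
  induction n with
  | zero => simp [geomSumSum]
  | succ n ih =>
    rw [geomSumSum, Finset.sum_range_succ, ← geomSumSum, ih, geomSum_zero]
    push_cast
    ring

theorem continuous_geomSum (n : ℕ) : Continuous fun u => geomSum u n := by
  unfold geomSum; fun_prop

theorem continuous_geomSumSum (n : ℕ) : Continuous fun u => geomSumSum u n := by
  unfold geomSumSum geomSum; fun_prop

variable {u : ℝ}

theorem geomSum_nonneg (hu : u ∈ Set.Icc (0 : ℝ) 1) (n : ℕ) : 0 ≤ geomSum u n :=
  Finset.sum_nonneg fun _ _ => pow_nonneg (by linarith [hu.2]) _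

theorem geomSum_le (hu : u ∈ Set.Icc (0 : ℝ) 1) (n : ℕ) : geomSum u n ≤ n := by
  refine (Finset.sum_le_card_nsmul _ _ 1 fun j _ => ?_).trans (by simp)
  exact pow_le_one₀ (by linarith [hu.2]) (by linarith [hu.1])

theorem geomSumSum_nonneg (hu : u ∈ Set.Icc (0 : ℝ) 1) (n : ℕ) : 0 ≤ geomSumSum u n :=
  Finset.sum_nonneg fun i _ => geomSum_nonneg hu i

theorem geomSumSum_le (hu : u ∈ Set.Icc (0 : ℝ) 1) (n : ℕ) : geomSumSum u n ≤ (n : ℝ) ^ 2 := by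
  refine (Finset.sum_le_card_nsmul _ _ (n : ℝ) fun i hi => (geomSum_le hu i).trans ?_).trans ?_
  · exact_mod_cast (Finset.mem_range.1 hi).le
  · simp [sq]

/-- The increments are `1 - (1 - u) ^ n ≥ 0`. This is what turns `X ≤ Y` into a comparison of the
first-order errors `E[X] - E[geomSum u X]`, with no second moment. -/
theorem monotone_sub_geomSum (hu : u ∈ Set.Icc (0 : ℝ) 1) :
    Monotone fun n : ℕ => (n : ℝ) - geomSum u n := by
  refine monotone_nat_of_le_succ fun n => ?_
  have h : (1 - u) ^ n ≤ 1 := pow_le_one₀ (by linarith [hu.2]) (by linarith [hu.1])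
  rw [geomSum, geomSum, Finset.sum_range_succ]
  push_cast
  linarith

theorem pow_le_one_of_mem (hu : u ∈ Set.Icc (0 : ℝ) 1) (n : ℕ) :
    0 ≤ (1 - u) ^ n ∧ (1 - u) ^ n ≤ 1 :=
  ⟨pow_nonneg (by linarith [hu.2]) _, pow_le_one₀ (by linarith [hu.2]) (by linarith [hu.1])⟩

variable {Ω : Type*} [MeasurableSpace Ω] {P : Measure Ω} {X : Ω → ℕ}

theorem integrable_pow_comp [IsProbabilityMeasure P] (hX : Measurable X)
    (hu : u ∈ Set.Icc (0 : ℝ) 1) :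
    Integrable (fun ω => (1 - u) ^ X ω) P := by
  refine Integrable.of_bound (C := 1)
    ((measurable_of_countable fun n : ℕ => (1 - u) ^ n).comp hX).aestronglyMeasurable
    (ae_of_all _ fun ω => ?_)
  rw [Real.norm_of_nonneg (pow_le_one_of_mem hu _).1]
  exact (pow_le_one_of_mem hu _).2

theorem integral_pow_comp_mem [IsProbabilityMeasure P] (hX : Measurable X)
    (hu : u ∈ Set.Icc (0 : ℝ) 1) :
    ∫ ω, (1 - u) ^ X ω ∂P ∈ Set.Icc (0 : ℝ) 1 := by
  refine ⟨integral_nonneg fun ω => (pow_le_one_of_mem hu _).1, ?_⟩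
  refine (integral_mono (integrable_pow_comp hX hu) (integrable_const 1)
    fun ω => (pow_le_one_of_mem hu _).2).trans (by simp)

theorem integrable_geomSum (hX : Measurable X) (hi : Integrable (fun ω => (X ω : ℝ)) P)
    (hu : u ∈ Set.Icc (0 : ℝ) 1) : Integrable (fun ω => geomSum u (X ω)) P := by
  refine hi.mono' ((measurable_of_countable (geomSum u)).comp hX).aestronglyMeasurable
    (ae_of_all _ fun ω => ?_)
  rw [Real.norm_of_nonneg (geomSum_nonneg hu _)]
  exact geomSum_le hu _

theorem integral_pow_comp_eq [IsProbabilityMeasure P] (hX : Measurable X)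
    (hi : Integrable (fun ω => (X ω : ℝ)) P)
    (hu : u ∈ Set.Icc (0 : ℝ) 1) :
    ∫ ω, (1 - u) ^ X ω ∂P = 1 - u * ∫ ω, geomSum u (X ω) ∂P := by
  simp_rw [one_sub_pow_eq]
  rw [integral_sub (integrable_const 1) ((integrable_geomSum hX hi hu).const_mul u),
    integral_const_mul]
  simp

theorem one_sub_mul_mean_le [IsProbabilityMeasure P] (hX : Measurable X)
    (hi : Integrable (fun ω => (X ω : ℝ)) P) (hu : u ∈ Set.Icc (0 : ℝ) 1) :
    1 - u * ∫ ω, (X ω : ℝ) ∂P ≤ ∫ ω, (1 - u) ^ X ω ∂P := by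
  rw [integral_pow_comp_eq hX hi hu]
  have := mul_le_mul_of_nonneg_left
    (integral_mono (integrable_geomSum hX hi hu) hi fun ω => geomSum_le hu _) hu.1
  linarith

theorem integral_pow_comp_eq' [IsProbabilityMeasure P] (hX : Measurable X)
    (hi : Integrable (fun ω => (X ω : ℝ)) P)
    (hi2 : Integrable (fun ω => (X ω : ℝ) ^ 2) P) (hu : u ∈ Set.Icc (0 : ℝ) 1) :
    ∫ ω, (1 - u) ^ X ω ∂P =
      1 - u * ∫ ω, (X ω : ℝ) ∂P + u ^ 2 * ∫ ω, geomSumSum u (X ω) ∂P := by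
  have h : Integrable (fun ω => geomSumSum u (X ω)) P := by
    refine hi2.mono' ((measurable_of_countable (geomSumSum u)).comp hX).aestronglyMeasurable
      (ae_of_all _ fun ω => ?_)
    rw [Real.norm_of_nonneg (geomSumSum_nonneg hu _)]
    exact geomSumSum_le hu _
  rw [integral_pow_comp_eq hX hi hu]
  simp_rw [geomSum_eq]
  rw [integral_sub hi (h.const_mul u), integral_const_mul]
  ring

/-- Dominated convergence with bound `X`; the limit is taken within `[0, 1]` because the bounds on
`geomSum` hold there. -/
theorem tendsto_integral_geomSum (hX : Measurable X) (hi : Integrable (fun ω => (X ω : ℝ)) P) :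
    Tendsto (fun u => ∫ ω, geomSum u (X ω) ∂P) (𝓝[Set.Icc 0 1] 0)
      (𝓝 (∫ ω, (X ω : ℝ) ∂P)) := by
  refine tendsto_integral_filter_of_dominated_convergence (fun ω => (X ω : ℝ)) ?_ ?_ hi ?_
  · exact Eventually.of_forall fun u =>
      ((measurable_of_countable (geomSum u)).comp hX).aestronglyMeasurable
  · filter_upwards [self_mem_nhdsWithin] with u hu
    refine ae_of_all _ fun ω => ?_
    rw [Real.norm_of_nonneg (geomSum_nonneg hu _)]
    exact geomSum_le hu _
  · refine ae_of_all _ fun ω => ?_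
    rw [← geomSum_zero]
    exact (continuous_geomSum _).continuousWithinAt

theorem tendsto_integral_geomSumSum (hX : Measurable X)
    (hi2 : Integrable (fun ω => (X ω : ℝ) ^ 2) P) :
    Tendsto (fun u => ∫ ω, geomSumSum u (X ω) ∂P) (𝓝[Set.Icc 0 1] 0)
      (𝓝 (∫ ω, (X ω : ℝ) * (X ω - 1) / 2 ∂P)) := by
  refine tendsto_integral_filter_of_dominated_convergence (fun ω => (X ω : ℝ) ^ 2) ?_ ?_ hi2 ?_
  · exact Eventually.of_forall fun u =>
      ((measurable_of_countable (geomSumSum u)).comp hX).aestronglyMeasurable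
  · filter_upwards [self_mem_nhdsWithin] with u hu
    refine ae_of_all _ fun ω => ?_
    rw [Real.norm_of_nonneg (geomSumSum_nonneg hu _)]
    exact geomSumSum_le hu _
  · refine ae_of_all _ fun ω => ?_
    rw [← geomSumSum_zero]
    exact (continuous_geomSumSum _).continuousWithinAt

instance neBot_nhdsWithin_Ioc : (𝓝[Set.Ioc (0 : ℝ) 1] 0).NeBot := by
  rw [nhdsWithin_Ioc_eq_nhdsGT zero_lt_one]
  infer_instance

/-- A variable has finite mean if the slopes of its generating function at `1` are bounded. -/
theorem integrable_of_pow_le [IsProbabilityMeasure P] (hX : Measurable X) {C : ℝ}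
    (h : ∀ u ∈ Set.Ioc (0 : ℝ) 1, 1 - C * u ≤ ∫ ω, (1 - u) ^ X ω ∂P) :
    Integrable (fun ω => (X ω : ℝ)) P := by
  have hmem : ∀ n : ℕ, (1 / ((n : ℝ) + 1)) ∈ Set.Ioc (0 : ℝ) 1 := fun n =>
    ⟨by positivity, by
      rw [div_le_one (by positivity)]
      linarith [n.cast_nonneg (α := ℝ)]⟩
  have hmeas : ∀ u, Measurable fun ω => geomSum u (X ω) := fun u =>
    (measurable_of_countable (geomSum u)).comp hX
  have hbound : ∀ u ∈ Set.Ioc (0 : ℝ) 1,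
      ∫⁻ ω, ENNReal.ofReal (geomSum u (X ω)) ∂P ≤ ENNReal.ofReal C := by
    intro u hu
    have hu' : u ∈ Set.Icc (0 : ℝ) 1 := ⟨hu.1.le, hu.2⟩
    have heq : ∀ n, geomSum u n = u⁻¹ * (1 - (1 - u) ^ n) := fun n => by
      rw [one_sub_pow_eq]
      field_simp [hu.1.ne']
      ring
    have hint : Integrable (fun ω => geomSum u (X ω)) P := by
      simp_rw [heq]
      exact ((integrable_const 1).sub (integrable_pow_comp hX hu')).const_mul _
    rw [← ofReal_integral_eq_lintegral_ofReal hint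
      (ae_of_all _ fun ω => geomSum_nonneg hu' _)]
    refine ENNReal.ofReal_le_ofReal ?_
    simp_rw [heq]
    rw [integral_const_mul, integral_sub (integrable_const 1) (integrable_pow_comp hX hu')]
    have := h u hu
    rw [inv_mul_le_iff₀ hu.1]
    simp only [integral_const, probReal_univ, one_smul]
    linarith
  refine ⟨(measurable_of_countable (fun n : ℕ => (n : ℝ))).comp hX |>.aestronglyMeasurable, ?_⟩
  rw [hasFiniteIntegral_iff_ofReal (ae_of_all _ fun ω => Nat.cast_nonneg _)]
  refine lt_of_le_of_lt ?_ (ENNReal.ofReal_lt_top (r := C))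
  -- Fatou's lemma along `u = 1 / (n + 1)`.
  have hlim : ∀ ω, liminf (fun n : ℕ =>
      ENNReal.ofReal (geomSum (1 / ((n : ℝ) + 1)) (X ω))) atTop = ENNReal.ofReal (X ω) := by
    intro ω
    refine Tendsto.liminf_eq (ENNReal.tendsto_ofReal ?_)
    have := ((continuous_geomSum (X ω)).tendsto 0).comp
      (tendsto_one_div_add_atTop_nhds_zero_nat (𝕜 := ℝ))
    rwa [geomSum_zero] at this
  simp_rw [← hlim]
  refine (lintegral_liminf_le fun n => (hmeas _).ennreal_ofReal).trans ?_
  refine liminf_le_of_le (by isBoundedDefault) fun b hb => ?_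
  obtain ⟨n, hn⟩ := hb.exists
  exact hn.trans (hbound _ (hmem n))

end Expansion

/-! ### Moments of the solutions of the parking equation -/

section ParkingEquation

open Filter Topology

variable {Ω : Type*} [MeasurableSpace Ω] {P : Measure Ω} [IsProbabilityMeasure P]
  {ν ρ : Measure ℕ} [IsProbabilityMeasure ν] [IsProbabilityMeasure ρ] {X Y : Ω → ℕ} {p : ℝ}

/-- The equation satisfied by the generating functions of `X` and `Y` if `Y` has the law of
`(L + X₁ + ⋯ + X_K - 1)⁺`, where `X₁, X₂, …` are independent copies of `X` and `p` is the
probability that `L + X₁ + ⋯ + X_K = 0`. -/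
def ParkingEquation (P : Measure Ω) (ν ρ : Measure ℕ) (p : ℝ) (X Y : Ω → ℕ) : Prop :=
  ∀ u ∈ Set.Ioc (0 : ℝ) 1, (1 - u) * ∫ ω, (1 - u) ^ Y ω ∂P =
    (∫ n, (1 - u) ^ n ∂ρ) * (∫ n, (∫ ω, (1 - u) ^ X ω ∂P) ^ n ∂ν) - u * p

/-- The laws `ρ` and `ν` are expanded to second order, but `X` and `Y` only through `W = E[geomSum u
X]` and `V = E[geomSum u Y]`, so finite means suffice for them. -/
theorem ParkingEquation.exists_remainder (h : ParkingEquation P ν ρ p X Y)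
    (hX : Measurable X) (hY : Measurable Y)
    (hXi : Integrable (fun ω => (X ω : ℝ)) P) (hYi : Integrable (fun ω => (Y ω : ℝ)) P)
    (hν : MemLp (fun n : ℕ => (n : ℝ)) 2 ν) (hν1 : ∫ n : ℕ, (n : ℝ) ∂ν = 1)
    (hρ : MemLp (fun n : ℕ => (n : ℝ)) 2 ρ) :
    ∃ R : ℝ → ℝ, Tendsto R (𝓝[Set.Ioc 0 1] 0) (𝓝 (∫ ω, (Y ω : ℝ) ∂P -
        (∫ ω, (X ω : ℝ) ∂P) ^ 2 * (∫ n : ℕ, (n : ℝ) * (n - 1) / 2 ∂ν) -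
        (∫ n : ℕ, (n : ℝ) ∂ρ) * (∫ ω, (X ω : ℝ) ∂P) - ∫ n : ℕ, (n : ℝ) * (n - 1) / 2 ∂ρ)) ∧
      ∀ u ∈ Set.Ioc (0 : ℝ) 1, (∫ ω, geomSum u (Y ω) ∂P) - (∫ ω, geomSum u (X ω) ∂P) -
        ((∫ n : ℕ, (n : ℝ) ∂ρ) + p - 1) = u * R u := by
  set a := ∫ n : ℕ, (n : ℝ) ∂ρ
  set V : ℝ → ℝ := fun u => ∫ ω, geomSum u (Y ω) ∂P
  set W : ℝ → ℝ := fun u => ∫ ω, geomSum u (X ω) ∂P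
  set G : ℝ → ℝ := fun u => ∫ n : ℕ, geomSumSum u n ∂ρ
  set F : ℝ → ℝ := fun u => ∫ n : ℕ, geomSumSum u n ∂ν
  have hle : 𝓝[Set.Ioc (0 : ℝ) 1] 0 ≤ 𝓝[Set.Icc (0 : ℝ) 1] 0 :=
    nhdsWithin_mono _ Set.Ioc_subset_Icc_self
  have hV := (tendsto_integral_geomSum hY hYi).mono_left hle
  have hW := (tendsto_integral_geomSum hX hXi).mono_left hle
  have hG := (tendsto_integral_geomSumSum (P := ρ) measurable_id hρ.integrable_sq).mono_left hle
  have hF := tendsto_integral_geomSumSum (P := ν) measurable_id hν.integrable_sq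
  have hu0 : Tendsto (fun u : ℝ => u) (𝓝[Set.Ioc 0 1] 0) (𝓝 0) := nhdsWithin_le_nhds
  have hwX : ∀ u ∈ Set.Icc (0 : ℝ) 1, ∫ ω, (1 - u) ^ X ω ∂P = 1 - u * W u := fun u hu =>
    integral_pow_comp_eq hX hXi hu
  have hwmem : ∀ u ∈ Set.Icc (0 : ℝ) 1, u * W u ∈ Set.Icc (0 : ℝ) 1 := by
    intro u hu
    have := integral_pow_comp_mem (P := P) hX hu
    rw [hwX u hu] at this
    exact ⟨by linarith [this.2], by linarith [this.1]⟩
  -- The generating function of `ν` is evaluated at `1 - u W(u)`, so its own expansion is used at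
  -- the small parameter `u W(u) ∈ [0, 1]`.
  have hw : Tendsto (fun u => u * W u) (𝓝[Set.Ioc 0 1] 0) (𝓝[Set.Icc 0 1] 0) := by
    refine tendsto_nhdsWithin_iff.2 ⟨by simpa using hu0.mul hW, ?_⟩
    filter_upwards [self_mem_nhdsWithin] with u hu
    exact hwmem u (Set.Ioc_subset_Icc_self hu)
  have hFw := hF.comp hw
  -- Expanding both sides of the equation and dividing by `u` leaves `V - W - (a + p - 1)` equal to
  -- `u` times this expression.
  refine ⟨fun u => V u - W u ^ 2 * F (u * W u) - a * W u - G u +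
    u * (a * (W u ^ 2 * F (u * W u)) + G u * W u) - u * u * (G u * (W u ^ 2 * F (u * W u))),
    ?_, ?_⟩
  · have hB := (hW.pow 2).mul hFw
    have := (((hV.sub hB).sub (hW.const_mul a)).sub hG).add
      (hu0.mul ((hB.const_mul a).add (hG.mul hW))) |>.sub ((hu0.mul hu0).mul (hG.mul hB))
    simpa using this
  · intro u hu
    have hu' := Set.Ioc_subset_Icc_self hu
    have h1 := h u hu
    rw [hwX u hu', integral_pow_comp_eq hY hYi hu',
      integral_pow_comp_eq' (P := ρ) (X := fun n => n) measurable_id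
        (hρ.integrable one_le_two) hρ.integrable_sq hu',
      integral_pow_comp_eq' (P := ν) (X := fun n => n) measurable_id
        (hν.integrable one_le_two) hν.integrable_sq (hwmem u hu'),
      hν1] at h1
    change (1 - u) * (1 - u * V u) = (1 - u * a + u ^ 2 * G u) *
      (1 - u * W u * 1 + (u * W u) ^ 2 * F (u * W u)) - u * p at h1
    refine mul_left_cancel₀ hu.1.ne' ?_
    linear_combination -h1

theorem ParkingEquation.mean_eq (h : ParkingEquation P ν ρ p X Y)
    (hX : Measurable X) (hY : Measurable Y)
    (hXi : Integrable (fun ω => (X ω : ℝ)) P) (hYi : Integrable (fun ω => (Y ω : ℝ)) P)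
    (hν : MemLp (fun n : ℕ => (n : ℝ)) 2 ν) (hν1 : ∫ n : ℕ, (n : ℝ) ∂ν = 1)
    (hρ : MemLp (fun n : ℕ => (n : ℝ)) 2 ρ) :
    ∫ ω, (Y ω : ℝ) ∂P = ∫ ω, (X ω : ℝ) ∂P + ∫ n : ℕ, (n : ℝ) ∂ρ + p - 1 := by
  obtain ⟨R, hR, hR'⟩ := h.exists_remainder hX hY hXi hYi hν hν1 hρ
  have hle : 𝓝[Set.Ioc (0 : ℝ) 1] 0 ≤ 𝓝[Set.Icc (0 : ℝ) 1] 0 :=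
    nhdsWithin_mono _ Set.Ioc_subset_Icc_self
  have hu0 : Tendsto (fun u : ℝ => u) (𝓝[Set.Ioc 0 1] 0) (𝓝 0) := nhdsWithin_le_nhds
  have h1 := (((tendsto_integral_geomSum hY hYi).sub
    (tendsto_integral_geomSum hX hXi)).sub_const (∫ n : ℕ, (n : ℝ) ∂ρ + p - 1)).mono_left hle
  have h2 := hu0.mul hR
  have h3 := tendsto_nhds_unique (h1.congr' (by
    filter_upwards [self_mem_nhdsWithin] with u hu using hR' u hu)) h2
  linarith

/-- From `X ≤ Y` one gets `V - W ≤ E[Y] - E[X] = a + p - 1`, so the remainder `R` is nonpositive,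
and so is its limit. -/
theorem ParkingEquation.mean_le (h : ParkingEquation P ν ρ p X Y)
    (hX : Measurable X) (hY : Measurable Y)
    (hXi : Integrable (fun ω => (X ω : ℝ)) P) (hYi : Integrable (fun ω => (Y ω : ℝ)) P)
    (hν : MemLp (fun n : ℕ => (n : ℝ)) 2 ν) (hν1 : ∫ n : ℕ, (n : ℝ) ∂ν = 1)
    (hρ : MemLp (fun n : ℕ => (n : ℝ)) 2 ρ) (hXY : ∀ᵐ ω ∂P, X ω ≤ Y ω) :
    ∫ ω, (Y ω : ℝ) ∂P ≤ (∫ ω, (X ω : ℝ) ∂P) ^ 2 * (∫ n : ℕ, (n : ℝ) * (n - 1) / 2 ∂ν) +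
      (∫ n : ℕ, (n : ℝ) ∂ρ) * (∫ ω, (X ω : ℝ) ∂P) + ∫ n : ℕ, (n : ℝ) * (n - 1) / 2 ∂ρ := by
  have hmean := h.mean_eq hX hY hXi hYi hν hν1 hρ
  obtain ⟨R, hR, hR'⟩ := h.exists_remainder hX hY hXi hYi hν hν1 hρ
  have hle : ∀ᶠ u in 𝓝[Set.Ioc (0 : ℝ) 1] 0, R u ≤ 0 := by
    filter_upwards [self_mem_nhdsWithin] with u hu
    have hu' := Set.Ioc_subset_Icc_self hu
    have hmono : ∫ ω, ((X ω : ℝ) - geomSum u (X ω)) ∂P ≤ ∫ ω, ((Y ω : ℝ) - geomSum u (Y ω)) ∂P :=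
      integral_mono_ae (hXi.sub (integrable_geomSum hX hXi hu'))
        (hYi.sub (integrable_geomSum hY hYi hu'))
        (hXY.mono fun ω hω => monotone_sub_geomSum hu' hω)
    rw [integral_sub hXi (integrable_geomSum hX hXi hu'),
      integral_sub hYi (integrable_geomSum hY hYi hu')] at hmono
    have := hR' u hu
    exact nonpos_of_mul_nonpos_right (by linarith) hu.1
  have := le_of_tendsto hR hle
  linarith

/-- With `Y = X` the first-order identity reads `a + p - 1 = 0`, so `R` vanishes identically on `(0,
1]`. -/
theorem ParkingEquation.mean_fixed (h : ParkingEquation P ν ρ p X X)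
    (hX : Measurable X) (hXi : Integrable (fun ω => (X ω : ℝ)) P)
    (hν : MemLp (fun n : ℕ => (n : ℝ)) 2 ν) (hν1 : ∫ n : ℕ, (n : ℝ) ∂ν = 1)
    (hρ : MemLp (fun n : ℕ => (n : ℝ)) 2 ρ) :
    ∫ ω, (X ω : ℝ) ∂P = (∫ ω, (X ω : ℝ) ∂P) ^ 2 * (∫ n : ℕ, (n : ℝ) * (n - 1) / 2 ∂ν) +
      (∫ n : ℕ, (n : ℝ) ∂ρ) * (∫ ω, (X ω : ℝ) ∂P) + ∫ n : ℕ, (n : ℝ) * (n - 1) / 2 ∂ρ := by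
  have hmean := h.mean_eq hX hX hXi hXi hν hν1 hρ
  obtain ⟨R, hR, hR'⟩ := h.exists_remainder hX hX hXi hXi hν hν1 hρ
  have hzero : ∀ᶠ u in 𝓝[Set.Ioc (0 : ℝ) 1] 0, R u = 0 := by
    filter_upwards [self_mem_nhdsWithin] with u hu
    have := hR' u hu
    exact (mul_eq_zero.1 (by linarith : u * R u = 0)).resolve_left hu.1.ne'
  have := tendsto_nhds_unique (hR.congr' hzero) tendsto_const_nhds
  linarith

/-- The inequality `xy ≥ x + y - 1` for `x, y ∈ [0, 1]`, applied to the two generating functions on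
the right, bounds `1 - E[(1 - u) ^ Y]` linearly in `u`. -/
theorem ParkingEquation.integrable (h : ParkingEquation P ν ρ p X Y)
    (hX : Measurable X) (hY : Measurable Y) (hXi : Integrable (fun ω => (X ω : ℝ)) P)
    (hν : MemLp (fun n : ℕ => (n : ℝ)) 2 ν) (hν1 : ∫ n : ℕ, (n : ℝ) ∂ν = 1)
    (hρ : MemLp (fun n : ℕ => (n : ℝ)) 2 ρ) :
    Integrable (fun ω => (Y ω : ℝ)) P := by
  refine integrable_of_pow_le hY
    (C := ∫ n : ℕ, (n : ℝ) ∂ρ + ∫ ω, (X ω : ℝ) ∂P + p) fun u hu => ?_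
  have hu' := Set.Ioc_subset_Icc_self hu
  have hρi := hρ.integrable one_le_two
  have hνi := hν.integrable one_le_two
  have hY1 := integral_pow_comp_mem (P := P) hY hu'
  have hX1 := integral_pow_comp_mem (P := P) hX hu'
  have hw : 1 - ∫ ω, (1 - u) ^ X ω ∂P ∈ Set.Icc (0 : ℝ) 1 :=
    ⟨by linarith [hX1.2], by linarith [hX1.1]⟩
  have hρ1 := integral_pow_comp_mem (P := ρ) (X := fun n => n) measurable_id hu'
  have hν2 := integral_pow_comp_mem (P := ν) (X := fun n => n) measurable_id hw
  have h1 := one_sub_mul_mean_le (P := ρ) (X := fun n => n) measurable_id hρi hu'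
  have h2 := one_sub_mul_mean_le (P := ν) (X := fun n => n) measurable_id hνi hw
  have h3 := one_sub_mul_mean_le hX hXi hu'
  have h4 := h u hu
  rw [hν1] at h2
  simp only [sub_sub_cancel] at h2 hν2
  have h5 := mul_nonneg hu.1.le hY1.1
  nlinarith [mul_nonneg (sub_nonneg.2 hρ1.2) (sub_nonneg.2 hν2.2)]

end ParkingEquation

/-! ### The mean flux of a critical Galton-Watson tree -/

section GaltonWatson

open Filter Topology

theorem measurable_sum_range {Ω : Type*} [MeasurableSpace Ω] {k : Ω → ℕ} (hk : Measurable k)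
    {f : ℕ → Ω → ℕ} (hf : ∀ i, Measurable (f i)) :
    Measurable fun ω => ∑ i ∈ Finset.range (k ω), f i ω := by
  have h : Measurable fun q : ℕ × Ω => ∑ i ∈ Finset.range q.1, f i q.2 :=
    measurable_from_prod_countable_right fun n =>
      Finset.measurable_sum (Finset.range n) fun i _ => hf i
  exact h.comp (hk.prodMk measurable_id)

theorem measurable_root_fst : Measurable fun ω : List ℕ → ℕ × ℕ => (ω []).1 := by fun_prop

theorem measurable_root_snd : Measurable fun ω : List ℕ → ℕ × ℕ => (ω []).2 := by fun_prop

theorem measurable_rootInflow {X : (List ℕ → ℕ × ℕ) → ℕ} (hX : Measurable X) :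
    Measurable fun ω : List ℕ → ℕ × ℕ =>
      (ω []).2 + ∑ i ∈ Finset.range (ω []).1, X (subtree i ω) :=
  measurable_root_snd.add
    (measurable_sum_range measurable_root_fst fun i => hX.comp (measurable_subtree i))

theorem measurable_levelFlux (n : ℕ) : Measurable (levelFlux n) := by
  induction n with
  | zero => exact measurable_const
  | succ n ih =>
    exact (measurable_of_countable fun m : ℕ => m - 1).comp (measurable_rootInflow ih)

theorem measurableSet_heightLT (n : ℕ) : MeasurableSet {ω | HeightLT n ω} := by
  induction n with
  | zero => exact MeasurableSet.empty
  | succ n ih =>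
    simp only [HeightLT, Set.ofPred_forall]
    refine MeasurableSet.iInter fun i => ?_
    have : {ω : List ℕ → ℕ × ℕ | i < (ω []).1 → HeightLT n (subtree i ω)} =
        {ω | i < (ω []).1}ᶜ ∪ subtree i ⁻¹' {ω | HeightLT n ω} := by
      ext ω
      simp [imp_iff_not_or]
    rw [this]
    exact (measurableSet_lt measurable_const measurable_root_fst).compl.union
      (measurable_subtree i ih)

theorem exists_heightLT_iff {ω : List ℕ → ℕ × ℕ} :
    (∃ n, HeightLT n ω) ↔ ∀ i < (ω []).1, ∃ n, HeightLT n (subtree i ω) := by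
  constructor
  · rintro ⟨n, h⟩ i hi
    exact ⟨n, h.succ i hi⟩
  · intro h
    choose f hf using h
    -- The sum serves as a common upper bound for the heights of the finitely many child subtrees.
    refine ⟨(∑ i ∈ (Finset.range (ω []).1).attach, f i (Finset.mem_range.1 i.2)) + 1,
      fun i hi => (hf i hi).mono ?_⟩
    exact Finset.single_le_sum
      (f := fun i : {x // x ∈ Finset.range (ω []).1} => f i (Finset.mem_range.1 i.2))
      (fun _ _ => Nat.zero_le _) (Finset.mem_attach _ ⟨i, Finset.mem_range.2 hi⟩)

variable {ν ρ : Measure ℕ} [IsProbabilityMeasure ν] [IsProbabilityMeasure ρ]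

/-- The law of the offspring numbers and the car arrivals. -/
noncomputable abbrev markedLaw (ν ρ : Measure ℕ) [IsProbabilityMeasure ν]
    [IsProbabilityMeasure ρ] : Measure (List ℕ → ℕ × ℕ) :=
  Measure.infinitePi fun _ : List ℕ => ν.prod ρ

theorem eq_dirac_of_ae_le_one (hi : Integrable (fun n : ℕ => (n : ℝ)) ν)
    (hν1 : ∫ n : ℕ, (n : ℝ) ∂ν = 1) (hle : ∀ᵐ n : ℕ ∂ν, (n : ℝ) ≤ 1) : ν = Measure.dirac 1 := by
  have h2 : ∫ n : ℕ, (1 - (n : ℝ)) ∂ν = 0 := by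
    rw [integral_sub (integrable_const 1) hi, hν1]
    simp
  have h3 := (integral_eq_zero_iff_of_nonneg_ae
    (hle.mono fun n hn => by simpa using hn) ((integrable_const 1).sub hi)).1 h2
  have h4 : (fun n : ℕ => n) =ᵐ[ν] fun _ => 1 := by
    filter_upwards [h3] with n hn
    have hn' : (n : ℝ) = 1 := (sub_eq_zero.1 hn).symm
    exact Nat.cast_eq_one.1 hn'
  have h5 : ν.map (fun n => n) = ν.map fun _ => 1 := Measure.map_congr h4
  rwa [Measure.map_const, measure_univ, one_smul, Measure.map_id'] at h5

/-- A law on `ℕ` with mean `1` is `δ₁` if its generating function has a fixed point other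
than `1`. -/
theorem eq_dirac_of_integral_pow_eq (hν : MemLp (fun n : ℕ => (n : ℝ)) 2 ν)
    (hν1 : ∫ n : ℕ, (n : ℝ) ∂ν = 1) {u : ℝ} (hu : u ∈ Set.Ioc (0 : ℝ) 1)
    (h : ∫ n : ℕ, (1 - u) ^ n ∂ν = 1 - u) : ν = Measure.dirac 1 := by
  have hu' := Set.Ioc_subset_Icc_self hu
  have hint : Integrable (fun n : ℕ => geomSumSum u n) ν := by
    refine hν.integrable_sq.mono' (measurable_of_countable _).aestronglyMeasurable
      (ae_of_all _ fun n => ?_)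
    rw [Real.norm_of_nonneg (geomSumSum_nonneg hu' _)]
    exact geomSumSum_le hu' _
  rw [integral_pow_comp_eq' (X := fun n => n) measurable_id (hν.integrable one_le_two)
    hν.integrable_sq hu', hν1] at h
  have h0 : ∫ n : ℕ, geomSumSum u n ∂ν = 0 :=
    (mul_eq_zero.1 (by linarith : u ^ 2 * _ = 0)).resolve_left (pow_ne_zero 2 hu.1.ne')
  have hae := (integral_eq_zero_iff_of_nonneg (fun n => geomSumSum_nonneg hu' n) hint).1 h0
  have hle : ∀ᵐ n : ℕ ∂ν, (n : ℝ) ≤ 1 := by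
    filter_upwards [hae] with n hn
    by_contra hlt
    rw [not_le] at hlt
    have hn2 : 1 < n := by exact_mod_cast hlt
    -- For `n ≥ 2` the sum contains the term `geomSum u 1 = 1`, so it cannot vanish.
    have h1 : geomSum u 1 ≤ geomSumSum u n :=
      Finset.single_le_sum (f := fun i => geomSum u i) (fun i _ => geomSum_nonneg hu' i)
        (Finset.mem_range.2 hn2)
    simp only [Pi.zero_apply] at hn
    rw [hn] at h1
    norm_num [geomSum] at h1
  exact eq_dirac_of_ae_le_one (hν.integrable one_le_two) hν1 hle

/-- A critical Galton-Watson tree is almost surely finite. -/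
theorem ae_exists_heightLT (hν : MemLp (fun n : ℕ => (n : ℝ)) 2 ν)
    (hν1 : ∫ n : ℕ, (n : ℝ) ∂ν = 1) (hνd : ν ≠ Measure.dirac 1) :
    ∀ᵐ ω ∂markedLaw ν ρ, ∃ n, HeightLT n ω := by
  set A : Set (List ℕ → ℕ × ℕ) := {ω | ∃ n, HeightLT n ω}
  have hA : MeasurableSet A := by
    have : A = ⋃ n, {ω | HeightLT n ω} := by ext; simp [A]
    rw [this]
    exact MeasurableSet.iUnion measurableSet_heightLT
  have hφ : Measurable (A.indicator (1 : (List ℕ → ℕ × ℕ) → ENNReal)) :=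
    measurable_one.indicator hA
  have h := lintegral_branching (ν.prod ρ) (k := Prod.fst) measurable_fst
    (ψ := fun _ => 1) measurable_const hφ
  -- A tree has finite height iff all its child subtrees do, so the probability `q` of finite height
  -- is a fixed point of the generating function of `ν`.
  have hprod : ∀ ω : List ℕ → ℕ × ℕ, 1 * ∏ i ∈ Finset.range (ω []).1,
      A.indicator (1 : (List ℕ → ℕ × ℕ) → ENNReal) (subtree i ω) = A.indicator 1 ω := by
    intro ω
    rw [one_mul]
    by_cases hω : ω ∈ A
    · rw [Set.indicator_of_mem hω, Pi.one_apply]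
      refine Finset.prod_eq_one fun i hi => ?_
      have hi' : subtree i ω ∈ A := exists_heightLT_iff.1 hω i (Finset.mem_range.1 hi)
      rw [Set.indicator_of_mem hi', Pi.one_apply]
    · rw [Set.indicator_of_notMem hω]
      have : ¬ ∀ i < (ω []).1, ∃ n, HeightLT n (subtree i ω) := fun h =>
        hω (exists_heightLT_iff.2 h)
      push Not at this
      obtain ⟨i, hi, hn⟩ := this
      refine Finset.prod_eq_zero (Finset.mem_range.2 hi) (Set.indicator_of_notMem ?_ _)
      rintro ⟨n, h⟩
      exact hn n h
  simp_rw [hprod, lintegral_indicator_one hA, one_mul] at h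
  set q : ℝ := (markedLaw ν ρ).real A
  have hq : markedLaw ν ρ A = ENNReal.ofReal q := (ofReal_measureReal).symm
  have hq0 : 0 ≤ q := measureReal_nonneg
  have hq1 : q ≤ 1 := measureReal_le_one
  have hu : 1 - q ∈ Set.Icc (0 : ℝ) 1 := ⟨by linarith, by linarith⟩
  have hfix : ∫ n : ℕ, (1 - (1 - q)) ^ n ∂ν = 1 - (1 - q) := by
    have hnn := integral_pow_comp_mem (P := ν) (X := fun n => n) measurable_id hu
    have hint := integrable_pow_comp (P := ν) (X := fun n => n) measurable_id hu
    rw [sub_sub_cancel] at hnn hint ⊢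
    rw [← ENNReal.ofReal_eq_ofReal_iff hnn.1 hq0, ofReal_integral_eq_lintegral_ofReal hint
      (ae_of_all _ fun n => pow_nonneg hq0 n), ← hq, h]
    rw [← measurePreserving_fst (μ := ν) (ν := ρ) |>.lintegral_comp (measurable_of_countable _)]
    refine lintegral_congr fun a => ?_
    rw [ENNReal.ofReal_pow hq0, ← hq]
  have hq' : q = 1 := by
    by_contra hne
    exact hνd (eq_dirac_of_integral_pow_eq hν hν1
      ⟨sub_pos.2 (lt_of_le_of_ne hq1 hne), hu.2⟩ hfix)
  have h1 : markedLaw ν ρ A = 1 := by rw [hq, hq', ENNReal.ofReal_one]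
  exact (mem_ae_iff_prob_eq_one hA).2 h1

theorem integral_pow_rootInflow {X : (List ℕ → ℕ × ℕ) → ℕ} (hX : Measurable X) {u : ℝ}
    (hu : u ∈ Set.Icc (0 : ℝ) 1) :
    ∫ ω, (1 - u) ^ ((ω []).2 + ∑ i ∈ Finset.range (ω []).1, X (subtree i ω)) ∂markedLaw ν ρ =
      (∫ n, (1 - u) ^ n ∂ρ) * ∫ n, (∫ ω, (1 - u) ^ X ω ∂markedLaw ν ρ) ^ n ∂ν := by
  have hs : 0 ≤ 1 - u := sub_nonneg.2 hu.2
  have hx := integral_pow_comp_mem (P := markedLaw ν ρ) hX hu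
  have hxX := ofReal_integral_eq_lintegral_ofReal
    (integrable_pow_comp (P := markedLaw ν ρ) hX hu) (ae_of_all _ fun ω => pow_nonneg hs _)
  set x := ∫ ω, (1 - u) ^ X ω ∂markedLaw ν ρ
  have hx' : 1 - x ∈ Set.Icc (0 : ℝ) 1 := ⟨by linarith [hx.2], by linarith [hx.1]⟩
  have hφ : Measurable fun ω => ENNReal.ofReal ((1 - u) ^ X ω) :=
    (measurable_of_countable fun n : ℕ => ENNReal.ofReal ((1 - u) ^ n)).comp hX
  have h := lintegral_branching (ν.prod ρ) (k := Prod.fst) measurable_fst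
    (ψ := fun a => ENNReal.ofReal ((1 - u) ^ a.2)) (measurable_of_countable _) hφ
  have hρ0 := integral_pow_comp_mem (P := ρ) (X := fun n => n) measurable_id hu
  have hρi := integrable_pow_comp (P := ρ) (X := fun n => n) measurable_id hu
  have hν0 := integral_pow_comp_mem (P := ν) (X := fun n => n) measurable_id hx'
  have hνi := integrable_pow_comp (P := ν) (X := fun n => n) measurable_id hx'
  rw [sub_sub_cancel] at hν0 hνi
  rw [← ENNReal.ofReal_eq_ofReal_iff
      (integral_pow_comp_mem (measurable_rootInflow hX) hu).1 (mul_nonneg hρ0.1 hν0.1),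
    ofReal_integral_eq_lintegral_ofReal (integrable_pow_comp (measurable_rootInflow hX) hu)
      (ae_of_all _ fun ω => pow_nonneg hs _), ENNReal.ofReal_mul hρ0.1,
    ofReal_integral_eq_lintegral_ofReal hρi (ae_of_all _ fun n => pow_nonneg hs n),
    ofReal_integral_eq_lintegral_ofReal hνi (ae_of_all _ fun n => pow_nonneg hx.1 n)]
  refine Eq.trans (lintegral_congr fun ω => ?_) (h.trans ?_)
  · rw [pow_add, ENNReal.ofReal_mul (pow_nonneg hs _), ← Finset.prod_pow_eq_pow_sum,
      ENNReal.ofReal_prod_of_nonneg fun i _ => pow_nonneg hs _]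
  · rw [← hxX, mul_comm, ← lintegral_prod_mul (measurable_of_countable _).aemeasurable
      (measurable_of_countable _).aemeasurable]
    refine lintegral_congr fun a => ?_
    rw [mul_comm, ENNReal.ofReal_pow hx.1]

theorem parkingEquation_of_ae_eq {X Y : (List ℕ → ℕ × ℕ) → ℕ} (hX : Measurable X)
    (h : ∀ᵐ ω ∂markedLaw ν ρ,
      Y ω = ((ω []).2 + ∑ i ∈ Finset.range (ω []).1, X (subtree i ω)) - 1) :
    ∃ p, 0 ≤ p ∧ ParkingEquation (markedLaw ν ρ) ν ρ p X Y := by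
  set S : (List ℕ → ℕ × ℕ) → ℕ := fun ω =>
    (ω []).2 + ∑ i ∈ Finset.range (ω []).1, X (subtree i ω)
  have hS : Measurable S := measurable_rootInflow hX
  have hB : MeasurableSet {ω | S ω = 0} := hS (measurableSet_singleton 0)
  -- Pointwise, `(1 - u) * (1 - u) ^ (S - 1) = (1 - u) ^ S - u 1_{S = 0}`: the truncation at `S = 0`
  -- produces the term `u p` with `p = P(S = 0)`.
  refine ⟨(markedLaw ν ρ).real {ω | S ω = 0}, measureReal_nonneg, fun u hu => ?_⟩
  have hu' := Set.Ioc_subset_Icc_self hu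
  rw [← integral_pow_rootInflow hX hu', ← integral_const_mul, ← integral_indicator_one hB,
    ← integral_const_mul]
  refine Eq.trans (integral_congr_ae ?_) (integral_sub (integrable_pow_comp hS hu')
    (((integrable_const (1 : ℝ)).indicator hB).const_mul u))
  filter_upwards [h] with ω hω
  change (1 - u) * (1 - u) ^ Y ω = (1 - u) ^ S ω - u * {ω | S ω = 0}.indicator 1 ω
  change Y ω = S ω - 1 at hω
  by_cases h0 : S ω = 0
  · rw [Set.indicator_of_mem (show ω ∈ {ω | S ω = 0} from h0), hω, h0]
    simp
  · rw [Set.indicator_of_notMem (show ω ∉ {ω | S ω = 0} from h0), hω, ← pow_succ',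
      Nat.sub_add_cancel (Nat.pos_of_ne_zero h0)]
    simp

/-- On trees of finite height `levelFlux n` is eventually equal to the flux, so the flux is an
almost sure limit of measurable functions. -/
theorem aemeasurable_treeFlux (hν : MemLp (fun n : ℕ => (n : ℝ)) 2 ν)
    (hν1 : ∫ n : ℕ, (n : ℝ) ∂ν = 1) (hνd : ν ≠ Measure.dirac 1) :
    AEMeasurable (fun ω : List ℕ → ℕ × ℕ => treeFlux (fun u => (ω u).1) (fun u => (ω u).2))
      (markedLaw ν ρ) := by
  refine aemeasurable_of_tendsto_metrizable_ae atTop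
    (fun n => (measurable_levelFlux n).aemeasurable) ?_
  filter_upwards [ae_exists_heightLT (ρ := ρ) hν hν1 hνd] with ω hω
  obtain ⟨n, hn⟩ := hω
  exact tendsto_const_nhds.congr' (eventually_atTop.2 ⟨n, fun n' hn' =>
    (hn.mono hn').treeFlux_eq⟩)

theorem meanFlux_eq_iSup (hν : MemLp (fun n : ℕ => (n : ℝ)) 2 ν)
    (hν1 : ∫ n : ℕ, (n : ℝ) ∂ν = 1) (hνd : ν ≠ Measure.dirac 1) :
    meanFlux ν ρ = ⨆ n, ∫⁻ ω, (levelFlux n ω : ENNReal) ∂markedLaw ν ρ := by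
  have hmono : ∀ ω, Monotone fun n => levelFlux n ω := fun ω =>
    monotone_nat_of_le_succ fun n => levelFlux_le_succ n ω
  refine Eq.trans (lintegral_congr_ae ?_) (lintegral_iSup
    (f := fun n ω => (levelFlux n ω : ENNReal)) (fun n =>
      (measurable_of_countable (fun m : ℕ => (m : ENNReal))).comp (measurable_levelFlux n))
    (fun n n' h ω => by simpa using hmono ω h))
  filter_upwards [ae_exists_heightLT (ρ := ρ) hν hν1 hνd] with ω hω
  obtain ⟨n, hn⟩ := hω
  refine le_antisymm ?_ (iSup_le fun n' => ?_)
  · rw [hn.treeFlux_eq]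
    exact le_iSup (fun n => (levelFlux n ω : ENNReal)) n
  · rw [(hn.mono (le_max_left n n')).treeFlux_eq]
    exact_mod_cast hmono ω (le_max_right n n')

theorem lintegral_natCast_eq {Ω : Type*} [MeasurableSpace Ω] {P : Measure Ω} {X : Ω → ℕ}
    (hi : Integrable (fun ω => (X ω : ℝ)) P) :
    ∫⁻ ω, (X ω : ENNReal) ∂P = ENNReal.ofReal (∫ ω, (X ω : ℝ) ∂P) := by
  rw [ofReal_integral_eq_lintegral_ofReal hi (ae_of_all _ fun ω => Nat.cast_nonneg _)]
  simp

theorem integral_mul_sub_one_nonneg (ρ : Measure ℕ) :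
    0 ≤ ∫ n : ℕ, (n : ℝ) * (n - 1) / 2 ∂ρ := by
  refine integral_nonneg fun n => ?_
  rw [← geomSumSum_zero]
  exact geomSumSum_nonneg ⟨le_rfl, zero_le_one⟩ n

/-- A nonnegative solution of the quadratic equation bounds the mean flux. -/
theorem meanFlux_le (hν : MemLp (fun n : ℕ => (n : ℝ)) 2 ν)
    (hν1 : ∫ n : ℕ, (n : ℝ) ∂ν = 1) (hνd : ν ≠ Measure.dirac 1)
    (hρ : MemLp (fun n : ℕ => (n : ℝ)) 2 ρ) {r : ℝ} (hr0 : 0 ≤ r)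
    (hr : r = r ^ 2 * (∫ n : ℕ, (n : ℝ) * (n - 1) / 2 ∂ν) + (∫ n : ℕ, (n : ℝ) ∂ρ) * r +
      ∫ n : ℕ, (n : ℝ) * (n - 1) / 2 ∂ρ) :
    meanFlux ν ρ ≤ ENNReal.ofReal r := by
  have ha : 0 ≤ ∫ n : ℕ, (n : ℝ) ∂ρ := integral_nonneg fun n => Nat.cast_nonneg _
  have hc : 0 ≤ ∫ n : ℕ, (n : ℝ) * (n - 1) / 2 ∂ν := integral_mul_sub_one_nonneg ν
  -- Finiteness of the mean and the bound by `r` propagate together: the quadratic map is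
  -- nondecreasing on `[0, ∞)` and fixes `r`.
  have key : ∀ n, Integrable (fun ω => (levelFlux n ω : ℝ)) (markedLaw ν ρ) ∧
      ∫ ω, (levelFlux n ω : ℝ) ∂markedLaw ν ρ ≤ r := by
    intro n
    induction n with
    | zero => simpa [levelFlux] using hr0
    | succ n ih =>
      obtain ⟨p, -, hp⟩ := parkingEquation_of_ae_eq (ν := ν) (ρ := ρ)
        (measurable_levelFlux n) (Y := levelFlux (n + 1)) (ae_of_all _ fun ω => rfl)
      have hi := hp.integrable (measurable_levelFlux n) (measurable_levelFlux _) ih.1 hν hν1 hρ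
      refine ⟨hi, (hp.mean_le (measurable_levelFlux n) (measurable_levelFlux _) ih.1 hi hν hν1 hρ
        (ae_of_all _ (levelFlux_le_succ n))).trans ?_⟩
      have h0 : 0 ≤ ∫ ω, (levelFlux n ω : ℝ) ∂markedLaw ν ρ :=
        integral_nonneg fun ω => Nat.cast_nonneg _
      conv_rhs => rw [hr]
      gcongr <;> exact ih.2
  rw [meanFlux_eq_iSup hν hν1 hνd]
  refine iSup_le fun n => ?_
  rw [lintegral_natCast_eq (key n).1]
  exact ENNReal.ofReal_le_ofReal (key n).2

/-- A finite mean flux solves the quadratic equation. -/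
theorem meanFlux_fixed (hν : MemLp (fun n : ℕ => (n : ℝ)) 2 ν)
    (hν1 : ∫ n : ℕ, (n : ℝ) ∂ν = 1) (hνd : ν ≠ Measure.dirac 1)
    (hρ : MemLp (fun n : ℕ => (n : ℝ)) 2 ρ) (hfin : meanFlux ν ρ ≠ ⊤) :
    ∫ n : ℕ, (n : ℝ) ∂ρ ≤ 1 ∧ (meanFlux ν ρ).toReal =
      (meanFlux ν ρ).toReal ^ 2 * (∫ n : ℕ, (n : ℝ) * (n - 1) / 2 ∂ν) +
        (∫ n : ℕ, (n : ℝ) ∂ρ) * (meanFlux ν ρ).toReal + ∫ n : ℕ, (n : ℝ) * (n - 1) / 2 ∂ρ := by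
  obtain ⟨X, hX, hXe⟩ := aemeasurable_treeFlux (ρ := ρ) hν hν1 hνd
  have hXm : ∫⁻ ω, (X ω : ENNReal) ∂markedLaw ν ρ = meanFlux ν ρ :=
    lintegral_congr_ae (hXe.mono fun ω hω => by simp only [hω])
  have hXi : Integrable (fun ω => (X ω : ℝ)) (markedLaw ν ρ) := by
    refine ⟨(measurable_of_countable (fun n : ℕ => (n : ℝ))).comp hX |>.aestronglyMeasurable, ?_⟩
    rw [hasFiniteIntegral_iff_ofReal (ae_of_all _ fun ω => Nat.cast_nonneg _)]
    simp only [ENNReal.ofReal_natCast]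
    rw [hXm]
    exact hfin.lt_top
  have hXr : ∫ ω, (X ω : ℝ) ∂markedLaw ν ρ = (meanFlux ν ρ).toReal := by
    rw [← hXm, lintegral_natCast_eq hXi,
      ENNReal.toReal_ofReal (integral_nonneg fun ω => Nat.cast_nonneg _)]
  -- The measurable version `X` agrees with the flux on all child subtrees simultaneously, since
  -- each `subtree i` preserves the measure.
  have hsub : ∀ᵐ ω ∂markedLaw ν ρ, ∀ i, treeFlux (fun u => (subtree i ω u).1)
      (fun u => (subtree i ω u).2) = X (subtree i ω) :=
    ae_all_iff.2 fun i => (measurePreserving_subtree (ν.prod ρ) i).quasiMeasurePreserving.ae hXe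
  obtain ⟨p, hp0, hp⟩ := parkingEquation_of_ae_eq (ν := ν) (ρ := ρ) (Y := X) hX (by
    filter_upwards [hXe, hsub, ae_exists_heightLT (ρ := ρ) hν hν1 hνd] with ω h1 h2 h3
    obtain ⟨n, hn⟩ := h3
    rw [← h1, treeFlux_eq_of_heightLT hn]
    simp only [h2])
  have h1 := hp.mean_eq hX hX hXi hXi hν hν1 hρ
  have h2 := hp.mean_fixed hX hXi hν hν1 hρ
  rw [hXr] at h1 h2
  exact ⟨by linarith, h2⟩

end GaltonWatson

/-! ### Thinned arrivals -/

section Thinning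

variable {μ : Measure ℕ}

theorem integrable_thinned (t : Set.Icc (0 : ℝ) 1) {f : ℕ → ℝ} (hf : Integrable f μ) :
    Integrable f (thinned μ t) :=
  ((integrable_dirac (by simp)).smul_measure ENNReal.ofReal_ne_top).add_measure
    (hf.smul_measure ENNReal.ofReal_ne_top)

theorem integral_thinned (t : Set.Icc (0 : ℝ) 1) {f : ℕ → ℝ} (hf : Integrable f μ) :
    ∫ n, f n ∂thinned μ t = (1 - t) * f 0 + t * ∫ n, f n ∂μ := by
  rw [thinned, integral_add_measure
    ((integrable_dirac (by simp)).smul_measure ENNReal.ofReal_ne_top)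
    (hf.smul_measure ENNReal.ofReal_ne_top), integral_smul_measure, integral_smul_measure,
    integral_dirac, ENNReal.toReal_ofReal (sub_nonneg.2 t.2.2), ENNReal.toReal_ofReal t.2.1]
  rfl

theorem map_prod_ite_eq_thinned [IsProbabilityMeasure μ] (t : Set.Icc (0 : ℝ) 1) :
    (((volume : Measure ℝ).restrict (Set.Icc 0 1)).prod μ).map
      (fun q : ℝ × ℕ => if q.1 ≤ t then q.2 else 0) = thinned μ t := by
  have hmeas : Measurable fun q : ℝ × ℕ => if q.1 ≤ (t : ℝ) then q.2 else 0 :=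
    Measurable.ite (measurableSet_le measurable_fst measurable_const) measurable_snd
      measurable_const
  ext s hs
  rw [Measure.map_apply hmeas hs]
  have hpre : (fun q : ℝ × ℕ => if q.1 ≤ (t : ℝ) then q.2 else 0) ⁻¹' s =
      Set.Iic (t : ℝ) ×ˢ s ∪ Set.Ioi (t : ℝ) ×ˢ {_n : ℕ | 0 ∈ s} := by
    ext ⟨a, n⟩
    by_cases h : a ≤ (t : ℝ)
    · simp [h]
    · simp [h, not_le.1 h]
  rw [hpre, measure_union ?_ (measurableSet_Ioi.prod (MeasurableSet.of_discrete)),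
    Measure.prod_prod, Measure.prod_prod, Measure.restrict_apply measurableSet_Iic,
    Measure.restrict_apply measurableSet_Ioi]
  · have h1 : Set.Iic (t : ℝ) ∩ Set.Icc 0 1 = Set.Icc 0 (t : ℝ) := by
      ext x
      simp only [Set.mem_inter_iff, Set.mem_Iic, Set.mem_Icc]
      exact ⟨fun h => ⟨h.2.1, h.1⟩, fun h => ⟨h.2, h.1, h.2.trans t.2.2⟩⟩
    have h2 : Set.Ioi (t : ℝ) ∩ Set.Icc 0 1 = Set.Ioc (t : ℝ) 1 := by
      ext x
      simp only [Set.mem_inter_iff, Set.mem_Ioi, Set.mem_Icc, Set.mem_Ioc]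
      exact ⟨fun h => ⟨h.1, h.2.2⟩, fun h => ⟨h.1, t.2.1.trans h.1.le, h.2⟩⟩
    rw [h1, h2, Real.volume_Icc, Real.volume_Ioc, sub_zero, add_comm]
    simp only [thinned, Measure.add_apply, Measure.smul_apply, smul_eq_mul,
      Measure.dirac_apply' _ hs]
    by_cases h0 : 0 ∈ s <;> simp [h0]
  · refine Set.disjoint_left.2 ?_
    rintro ⟨a, n⟩ ⟨h1, -⟩ ⟨h2, -⟩
    exact not_le.2 (Set.mem_Ioi.1 h2) (Set.mem_Iic.1 h1)

/-- The pairs of offspring number and thinned arrival number are i.i.d. with law `ν ⊗ μ_t`, so their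
joint law is the product measure defining `meanFlux`. -/
theorem lintegral_treeFlux_arrivedBy [IsProbabilityMeasure μ] {ν : Measure ℕ}
    [IsProbabilityMeasure ν]
    (hν : MemLp (fun n : ℕ => (n : ℝ)) 2 ν) (hν1 : ∫ n : ℕ, (n : ℝ) ∂ν = 1)
    (hνd : ν ≠ Measure.dirac 1)
    {Ω : Type*} [MeasurableSpace Ω] (P : Measure Ω)
    (K : List ℕ → Ω → ℕ) (A : List ℕ → Ω → ℝ) (L : List ℕ → Ω → ℕ)
    (hmeas : ∀ u, Measurable fun ω => (K u ω, A u ω, L u ω))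
    (hindep : iIndepFun (fun u ω => (K u ω, A u ω, L u ω)) P)
    (hlaw : ∀ u, P.map (fun ω => (K u ω, A u ω, L u ω)) =
      ν.prod (((volume : Measure ℝ).restrict (Set.Icc 0 1)).prod μ))
    (t : Set.Icc (0 : ℝ) 1) :
    ∫⁻ ω, (treeFlux (fun u => K u ω)
        (arrivedBy t (fun u => A u ω) (fun u => L u ω)) : ENNReal) ∂P =
      meanFlux ν (thinned μ t) := by
  have hthin : Measurable fun q : ℝ × ℕ => if q.1 ≤ (t : ℝ) then q.2 else 0 :=
    Measurable.ite (measurableSet_le measurable_fst measurable_const) measurable_snd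
      measurable_const
  set g : ℕ × ℝ × ℕ → ℕ × ℕ := Prod.map id fun q => if q.1 ≤ (t : ℝ) then q.2 else 0
  have hg : Measurable g := measurable_id.prodMap hthin
  have hZ : ∀ u, Measurable fun ω => g (K u ω, A u ω, L u ω) := fun u => hg.comp (hmeas u)
  have hZlaw : ∀ u, P.map (fun ω => g (K u ω, A u ω, L u ω)) = ν.prod (thinned μ t) := by
    intro u
    refine (Measure.map_map hg (hmeas u)).symm.trans ?_
    rw [hlaw u, ← map_prod_ite_eq_thinned]
    conv_rhs => rw [← Measure.map_id (μ := ν)]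
    exact (Measure.map_prod_map _ _ measurable_id hthin).symm
  have hmap := (hindep.comp (fun _ => g) fun _ => hg).map_fun_eq_infinitePi_map hZ
  have hmap' : P.map (fun ω u => g (K u ω, A u ω, L u ω)) =
      Measure.infinitePi fun _ : List ℕ => ν.prod (thinned μ t) := by
    refine hmap.trans ?_
    congr 1
    funext u
    exact hZlaw u
  rw [meanFlux, ← hmap', lintegral_map' ?_ (measurable_pi_iff.2 hZ).aemeasurable]
  · rfl
  · rw [hmap']
    exact (measurable_of_countable (fun m : ℕ => (m : ENNReal))).comp_aemeasurable
      (aemeasurable_treeFlux hν hν1 hνd)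

end Thinning

/-! ### The discriminant -/

section Discriminant

variable {m b : ℝ}

/-- The discriminant is `1` at `0`, so a negative value at `t` would force a root in between. -/
theorem discriminant_nonneg {t : ℝ} (ht : 0 ≤ t)
    (h : ∀ s, 0 < s → s < t → (1 - m * s) ^ 2 ≠ s * b) : 0 ≤ (1 - m * t) ^ 2 - t * b := by
  by_contra hneg
  rw [not_le] at hneg
  have hc : ContinuousOn (fun s : ℝ => (1 - m * s) ^ 2 - s * b) (Set.Icc 0 t) := by fun_prop
  obtain ⟨s, hs, hs0⟩ := intermediate_value_Ioo' ht hc (show (0 : ℝ) ∈ _ from ⟨hneg, by simp⟩)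
  exact h s hs.1 hs.2 (sub_eq_zero.1 hs0)

/-- If `1/m < t`, the discriminant at `1/m` is `-b/m ≤ 0`. It is also nonnegative by
`discriminant_nonneg`, so `1/m` would be a root. -/
theorem mul_le_one_of_no_root (hb : 0 ≤ b) {t : ℝ} (ht : 0 ≤ t)
    (h : ∀ s, 0 < s → s < t → (1 - m * s) ^ 2 ≠ s * b) : m * t ≤ 1 := by
  by_contra hgt
  rw [not_le] at hgt
  have hm : 0 < m := by
    by_contra hm
    have := mul_nonpos_of_nonpos_of_nonneg (not_lt.1 hm) ht
    linarith
  have hs0 : 0 < 1 / m := by positivity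
  have hst : 1 / m < t := by rwa [div_lt_iff₀' hm]
  have h1 := discriminant_nonneg hs0.le fun s h1 h2 => h s h1 (h2.trans hst)
  have h2 : 1 - m * (1 / m) = 0 := by field_simp; ring
  have h3 := h _ hs0 hst
  rw [h2] at h1 h3
  refine h3 (le_antisymm ?_ ?_)
  · have := mul_nonneg hs0.le hb
    linarith
  · linarith

/-- While `m t ≤ 1`, the square decreases and `t b` increases, at least one of them strictly: if `m
= 0`, the root condition forces `b > 0`. -/
theorem discriminant_neg {s t : ℝ} (hm : 0 ≤ m) (hb : 0 ≤ b) (hs : 0 < s) (hst : s < t)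
    (hmt : m * t ≤ 1) (h : (1 - m * s) ^ 2 = s * b) : (1 - m * t) ^ 2 < t * b := by
  rcases hm.eq_or_lt with rfl | hm
  · have h1 := mul_lt_mul_of_pos_right hst (pos_of_mul_pos_right (a := s) (b := b)
      (by rw [← h]; norm_num) hs.le)
    simp only [zero_mul, sub_zero] at h ⊢
    linarith
  · have h1 : m * s < m * t := mul_lt_mul_of_pos_left hst hm
    have h2 : (1 - m * t) ^ 2 < (1 - m * s) ^ 2 :=
      pow_lt_pow_left₀ (by linarith) (by linarith) two_ne_zero
    have := mul_le_mul_of_nonneg_right hst.le hb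
    linarith

end Discriminant

/-! ### Factorial moments and the main theorem -/

theorem integral_mul_sub_one_div_two {ρ : Measure ℕ} [IsProbabilityMeasure ρ]
    (hρ : MemLp (fun n : ℕ => (n : ℝ)) 2 ρ) :
    ∫ n : ℕ, (n : ℝ) * (n - 1) / 2 ∂ρ = (natVar ρ + natMean ρ ^ 2 - natMean ρ) / 2 := by
  have h : ∀ n : ℕ, (n : ℝ) * (n - 1) / 2 = ((n : ℝ) ^ 2 - n) / 2 := fun n => by ring
  simp_rw [h]
  rw [integral_div, integral_sub hρ.integrable_sq (hρ.integrable one_le_two), natVar, natMean,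
    variance_eq_sub hρ]
  simp

theorem natVar_pos {ν : Measure ℕ} [IsProbabilityMeasure ν]
    (hν : MemLp (fun n : ℕ => (n : ℝ)) 2 ν) (hν1 : natMean ν = 1) (hνd : ν ≠ Measure.dirac 1) :
    0 < natVar ν := by
  refine lt_of_le_of_ne (variance_nonneg _ _) fun h => hνd ?_
  refine eq_dirac_of_ae_le_one (hν.integrable one_le_two) hν1 ?_
  filter_upwards [ae_eq_integral_of_variance_eq_zero hν h.symm] with n hn
  exact hn.le.trans hν1.le

theorem proposition3p1
    (ν μ : Measure ℕ) [IsProbabilityMeasure ν] [IsProbabilityMeasure μ]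
    -- the offspring distribution is critical, has finite variance and is not `δ₁`
    (hν2 : MemLp (fun n : ℕ => (n : ℝ)) 2 ν) (hν1 : natMean ν = 1)
    (hν : ν ≠ Measure.dirac 1)
    -- the law of the car arrivals has finite variance
    (hμ2 : MemLp (fun n : ℕ => (n : ℝ)) 2 μ)
    -- offspring numbers `K u`, arrival times `A u` and arrival numbers `L u`: the triples are
    -- i.i.d. with law `ν ⊗ Unif[0,1] ⊗ μ`
    {Ω : Type*} [MeasurableSpace Ω] (P : Measure Ω) [IsProbabilityMeasure P]
    (K : List ℕ → Ω → ℕ) (A : List ℕ → Ω → ℝ) (L : List ℕ → Ω → ℕ)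
    (hmeas : ∀ u, Measurable fun ω => (K u ω, A u ω, L u ω))
    (hindep : iIndepFun (fun u ω => (K u ω, A u ω, L u ω)) P)
    (hlaw : ∀ u, P.map (fun ω => (K u ω, A u ω, L u ω)) =
      ν.prod (((volume : Measure ℝ).restrict (Set.Icc 0 1)).prod μ))
    (m s2 S2 : ℝ) (hm : m = natMean μ) (hs2 : s2 = natVar μ) (hS2 : S2 = natVar ν)
    (t : Set.Icc (0 : ℝ) 1) :
    -- the mean of `φ(t)` is the mean flux with i.i.d. arrivals of law `μ_t`
    ∫⁻ ω, (treeFlux (fun u => K u ω) (arrivedBy t (fun u => A u ω) (fun u => L u ω)) : ENNReal) ∂P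
        = meanFlux ν (thinned μ t) ∧
    (((t : ℝ) : EReal) ≤ tMax m s2 S2 →
      (meanFlux ν (thinned μ t) : EReal) =
        ((((1 - m * t) - √((1 - m * t) ^ 2 - S2 * (s2 + m ^ 2 - m) * t)) / S2 : ℝ) : EReal)) ∧
    (tMax m s2 S2 < ((t : ℝ) : EReal) → meanFlux ν (thinned μ t) = ⊤) := by
  have ht0 : (0 : ℝ) ≤ t := t.2.1
  have hμi := hμ2.integrable one_le_two
  have hρ2 : MemLp (fun n : ℕ => (n : ℝ)) 2 (thinned μ t) :=
    (memLp_two_iff_integrable_sq (measurable_of_countable _).aestronglyMeasurable).2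
      (integrable_thinned t hμ2.integrable_sq)
  have hmean : ∫ n : ℕ, (n : ℝ) ∂thinned μ t = m * t := by
    rw [integral_thinned t hμi, hm, natMean]
    simp [mul_comm]
  set B : ℝ := s2 + m ^ 2 - m
  have hB : ∫ n : ℕ, (n : ℝ) * (n - 1) / 2 ∂μ = B / 2 := by
    rw [integral_mul_sub_one_div_two hμ2, ← hm, ← hs2]
  have hB0 : 0 ≤ B := by linarith [integral_mul_sub_one_nonneg μ]
  have hsecond : ∫ n : ℕ, (n : ℝ) * (n - 1) / 2 ∂thinned μ t = t * B / 2 := by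
    have hi : Integrable (fun n : ℕ => (n : ℝ) * (n - 1) / 2) μ := by
      refine ((hμ2.integrable_sq.sub hμi).div_const 2).congr (ae_of_all _ fun n => ?_)
      simp only [Pi.sub_apply]
      ring
    rw [integral_thinned t hi, hB]
    simp [mul_div_assoc]
  have hS : 0 < S2 := hS2 ▸ natVar_pos hν2 hν1 hν
  have hcν : ∫ n : ℕ, (n : ℝ) * (n - 1) / 2 ∂ν = S2 / 2 := by
    rw [integral_mul_sub_one_div_two hν2, ← hS2, hν1]
    ring
  have hm0 : 0 ≤ m := hm ▸ integral_nonneg fun n => Nat.cast_nonneg _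
  have hSB : 0 ≤ S2 * B := mul_nonneg hS.le hB0
  have hfixed := meanFlux_fixed hν2 hν1 hν hρ2
  have hle := fun {r : ℝ} => meanFlux_le hν2 hν1 hν hρ2 (r := r)
  rw [hmean, hsecond, hcν] at hfixed
  simp only [hmean, hsecond, hcν] at hle
  refine ⟨lintegral_treeFlux_arrivedBy hν2 hν1 hν P K A L hmeas hindep hlaw t, fun ht => ?_,
    fun ht => ?_⟩
  · have hroot : ∀ s, 0 < s → s < (t : ℝ) → (1 - m * s) ^ 2 ≠ s * (S2 * B) := by
      intro s hs hst heq
      have h1 : tMax m s2 S2 ≤ (s : EReal) := sInf_le ⟨s, ⟨hs, by rw [heq]; ring⟩, rfl⟩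
      exact absurd (EReal.coe_le_coe_iff.1 (ht.trans h1)) (not_le.2 hst)
    have hmt : 0 ≤ 1 - m * t := sub_nonneg.2 (mul_le_one_of_no_root hSB ht0 hroot)
    have hD : 0 ≤ (1 - m * t) ^ 2 - S2 * B * t := by
      linarith [discriminant_nonneg ht0 hroot, mul_comm (t : ℝ) (S2 * B)]
    have hq := Real.sq_sqrt hD
    have hq0 := Real.sqrt_nonneg ((1 - m * t) ^ 2 - S2 * B * t)
    have hqle : √((1 - m * t) ^ 2 - S2 * B * t) ≤ 1 - m * t := by
      rw [Real.sqrt_le_left hmt]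
      linarith [mul_nonneg hSB ht0]
    set q := √((1 - m * t) ^ 2 - S2 * B * t)
    set r := (1 - m * t - q) / S2
    have hrS : S2 * r = 1 - m * t - q := mul_div_cancel₀ _ hS.ne'
    have hr0 : 0 ≤ r := div_nonneg (by linarith) hS.le
    -- The candidate `r` is the smaller root of the quadratic equation.
    have hr : r = r ^ 2 * (S2 / 2) + m * t * r + t * B / 2 := by
      refine mul_left_cancel₀ (mul_pos hS two_pos).ne' ?_
      linear_combination (2 * (1 - m * t) - S2 * r - (1 - m * t - q)) * hrS - hq
    have hmf := hle hr0 hr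
    have hfin : meanFlux ν (thinned μ t) ≠ ⊤ := ne_top_of_le_ne_top ENNReal.ofReal_ne_top hmf
    obtain ⟨-, hh⟩ := hfixed hfin
    have hhr : (meanFlux ν (thinned μ t)).toReal ≤ r :=
      ENNReal.toReal_le_of_le_ofReal hr0 hmf
    set h := (meanFlux ν (thinned μ t)).toReal
    -- If `h < r`, then `S2 * h - (1 - m * t) < -q ≤ 0`, which contradicts that its square is `q ^
    -- 2`.
    have heq : h = r := by
      refine le_antisymm hhr (not_lt.1 fun hlt => ?_)
      have h1 : S2 * h < S2 * r := mul_lt_mul_of_pos_left hlt hS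
      have h2 : (S2 * h - (1 - m * t)) ^ 2 = q ^ 2 := by
        rw [hq]
        linear_combination (-2 * S2) * hh
      nlinarith
    rw [← heq, ← EReal.coe_toReal (x := (meanFlux ν (thinned μ t) : EReal)) (by simpa using hfin)
      (EReal.coe_ennreal_ne_bot _), EReal.toReal_coe_ennreal]
  · by_contra hfin
    obtain ⟨hmt, hh⟩ := hfixed hfin
    obtain ⟨_, ⟨s, ⟨hs, hroot⟩, rfl⟩, hst⟩ := sInf_lt_iff.1 ht
    have hneg := discriminant_neg hm0 hSB hs (EReal.coe_lt_coe_iff.1 hst) hmt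
      (by rw [hroot]; ring)
    set h := (meanFlux ν (thinned μ t)).toReal
    -- Completing the square in the quadratic equation for a finite mean `h` exhibits the negative
    -- discriminant as a square.
    have h2 : (S2 * h - (1 - m * t)) ^ 2 = (1 - m * t) ^ 2 - t * (S2 * B) := by
      linear_combination (-2 * S2) * hh
    linarith [sq_nonneg (S2 * h - (1 - m * t))]
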